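/- Let $(S,A)$ be an $m$-player game: $S=S_1\times\cdots\times S_m$ with arbitrary nonempty action sets $S_j$, and bounded payoff functions $A_j:S\to\mathbb{R}$. For each player $j$ put $\mathcal{X}_j=\{\,a\mapsto A_j(a,s_{-j}) : s_{-j}\in S_{-j}\,\}$, a class of real functions on $S_j$. A $\mathcal{Z}$-valued tree of depth $d$ is a sequence $\mathbf z=(\mathbf z_1,\dots,\mathbf z_d)$ of maps $\mathbf z_t:\{-1,1\}^{t-1}\to\mathcal{Z}$. For a class $\mathcal{H}$ of real functions on $\mathcal{Z}$ define: * the sequential Rademacher complexity $\mathfrak{R}_T(\mathcal H)=\sup_{\mathbf z}\mathbb{E}_{\epsilon}\big[\sup_{h\in\mathcal H}\frac1T\sum_{t=1}^T\epsilon_t h(\mathbf z_t(\epsilon_{1:t-1}))\big]$, with $\mathbf z$ ranging over $\mathcal{Z}$-valued trees of depth $T$ and $\epsilon$ uniform on $\{-1,1\}^T$; * for $\delta>0$, the sequential fat-shattering dimension $\mathrm{sfat}_\delta(\mathcal H)$: the supremum of all $d$ for which there are a real-valued tree $\mathbf s$ and a $\mathcal{Z}$-valued tree $\mathbf z$ of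 depth $d$ such that for every $\epsilon\in\{-1,1\}^d$ some $h\in\mathcal H$ satisfies $\epsilon_t\big(h(\mathbf z_t(\epsilon_{1:t-1}))-\mathbf s_t(\epsilon_{1:t-1})\big)\ge\delta$ for all $t\le d$; * for $\{0,1\}$-valued $\mathcal H$, the Littlestone dimension $\mathrm{LDim}(\mathcal H)$: the supremum of all $d$ for which there is a $\mathcal{Z}$-valued tree $\mathbf z$ of depth $d$ such that for every $\epsilon\in\{-1,1\}^d$ some $h\in\mathcal H$ satisfies, for all $t\le d$, $h(\mathbf z_t(\epsilon_{1:t-1}))=1$ if $\epsilon_t=1$ and $=0$ if $\epsilon_t=-1$. Each of these is defined for the game as the maximum over $j$ of its values on $\mathcal X_1,\dots,\mathcal X_m$. For $\varepsilon>0$, an $\varepsilon$-correlated equilibrium ($\varepsilon$-CE) is a discrete probability distribution $\mu$ on $S$ such that, for every player $j$ and every map $\pi:S_j\to S_j$, $\mathbb{E}_{s\sim\mu}[A_j(\pi(s_j),s_{-j})]\le\mathbb{E}_{s\sim\mu}[A_j(s)]+\varepsilon$. **Corollary.** Suppose that either of the following holds: * $\mathfrak R_T(S,A)\to0$ as $T\to\infty$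 (which, in turn, holds if $\mathrm{sfat}_\delta(S,A)<\infty$ for all $\delta>0$); * all $A_j$ are $\{0,1\}$-valued and $\mathrm{LDim}(S,A)<\infty$. Then $(S,A)$ has an $\varepsilon$-CE for every $\varepsilon>0$. -/

import Mathlib

open Filter Topology

noncomputable section

namespace SeqGame

/-- The Rademacher sign of a bit: `true` stands for `+1` (right), `false` for `-1` (left). -/
def sgn (b : Bool) : ℝ := if b then 1 else -1

/-- A `Z`-valued complete binary tree of depth `d`, given by its levels: the node at level `t`
reached by the path `ε₀, …, ε_{t-1}` is labelled `z t (ε₀, …, ε_{t-1})`. -/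
abbrev BTree (Z : Type*) (d : ℕ) : Type _ := (t : Fin d) → (Fin t → Bool) → Z

/-- The label met by the tree `z` at level `t` along the branch `ε`. -/
def BTree.along {Z : Type*} {d : ℕ} (z : BTree Z d) (ε : Fin d → Bool) (t : Fin d) : Z :=
  z t (fun i => ε (Fin.castLE t.isLt.le i))

/-- The sequential Rademacher complexity at depth `T` of a class `H` of real functions on `Z`
(used for nonempty, uniformly bounded classes, for which both suprema are of nonempty bounded sets
of reals when `Z` is nonempty). The average over all `2 ^ T` sign sequences is the expectation. -/
def seqRademacher {Z : Type*} (H : Set (Z → ℝ)) (T : ℕ) : ℝ :=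
  ⨆ z : BTree Z T,
    (∑ ε : Fin T → Bool,
      ⨆ h : H, (1 / (T : ℝ)) * ∑ t : Fin T, sgn (ε t) * (h : Z → ℝ) (z.along ε t)) / 2 ^ T

/-- The Littlestone dimension of a `{0,1}`-valued class: the supremum of the depths of the trees
all of whose branches are realized by the class (`⊤` if the depths are unbounded). -/
def littlestoneDim {Z : Type*} (H : Set (Z → ℝ)) : ℕ∞ :=
  ⨆ d ∈ {d : ℕ | ∃ z : BTree Z d, ∀ ε : Fin d → Bool, ∃ h ∈ H, ∀ t : Fin d,
    h (z.along ε t) = if ε t then 1 else 0}, (d : ℕ∞)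

/-- The sequential fat-shattering dimension at scale `δ`, `⊤` if there is no largest depth. -/
def seqFatDim {Z : Type*} (δ : ℝ) (H : Set (Z → ℝ)) : ℕ∞ :=
  ⨆ d ∈ {d : ℕ | ∃ (s : BTree ℝ d) (z : BTree Z d), ∀ ε : Fin d → Bool, ∃ h ∈ H, ∀ t : Fin d,
    δ ≤ sgn (ε t) * (h (z.along ε t) - s.along ε t)}, (d : ℕ∞)

/-- The function class of player `j`: the functions `a ↦ A j (a, s_{-j})` on the actions of
player `j`, where `s_{-j}` runs over the action profiles of the other players
(the `j`-th coordinate of `s` is overwritten and plays no role). -/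
def playerClass {m : ℕ} {S : Fin m → Type*} (A : Fin m → (∀ i, S i) → ℝ) (j : Fin m) :
    Set (S j → ℝ) :=
  Set.range fun (s : ∀ i, S i) (a : S j) => A j (Function.update s j a)

/-- The sequential Rademacher complexity of a game: the maximum over the players. -/
def gameSeqRademacher {m : ℕ} {S : Fin m → Type*} (A : Fin m → (∀ i, S i) → ℝ) (T : ℕ) : ℝ :=
  ⨆ j : Fin m, seqRademacher (playerClass A j) T

/-- The Littlestone dimension of a (binary-valued) game: the maximum over the players. -/
def gameLittlestoneDim {m : ℕ} {S : Fin m → Type*} (A : Fin m → (∀ i, S i) → ℝ) : ℕ∞ :=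
  ⨆ j : Fin m, littlestoneDim (playerClass A j)

/-- The sequential `δ`-fat-shattering dimension of a game: the maximum over the players. -/
def gameSeqFatDim {m : ℕ} {S : Fin m → Type*} (δ : ℝ) (A : Fin m → (∀ i, S i) → ℝ) : ℕ∞ :=
  ⨆ j : Fin m, seqFatDim δ (playerClass A j)

/-- All payoffs lie in `{0, 1}`. -/
def IsBinaryValued {m : ℕ} {S : Fin m → Type*} (A : Fin m → (∀ i, S i) → ℝ) : Prop :=
  ∀ j s, A j s = 0 ∨ A j s = 1

/-- The expectation of `f` under a discrete distribution
(the series converges absolutely for bounded `f`). -/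
def expect {α : Type*} (μ : PMF α) (f : α → ℝ) : ℝ := ∑' s, (μ s).toReal * f s

/-- `μ` is an `ε`-correlated equilibrium of the game with payoffs `A`: no player gains more than
`ε` in expectation by applying a deviation map to the action drawn for them. -/
def IsCorrelatedEq {m : ℕ} {S : Fin m → Type*} (A : Fin m → (∀ i, S i) → ℝ) (ε : ℝ)
    (μ : PMF (∀ i, S i)) : Prop :=
  ∀ (j : Fin m) (π : S j → S j),
    expect μ (fun s => A j (Function.update s j (π (s j)))) ≤ expect μ (fun s => A j s) + ε

end SeqGame

end

/-! The equilibrium is the average play of a tree of depth `K` whose nodes carry a mixed action for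
each player. A leaf plays independently, each player using the uniform average of the `K` mixed
actions on the path to that leaf. A swap `π` then acts separately on the `K` levels. If a node uses
`p` and the average function met below it is `q`, then `p (q ∘ π)` is at most the value of the best
fixed action against `q`. When the external regret on the level below is at most `ε`, this is at
most `ε` plus that level's average value. So the swap gain of a level is bounded by `ε` plus the
difference of the average values of two consecutive levels. The sum telescopes, and a large `K`
absorbs the boundary terms (`exists_outcome`, `exists_isCorrelatedEq`).

Small external regret comes from a minimax argument, not from an algorithm. The outcomes obtainable
below given ancestors form a convex set, and weighted external regret is bilinear in the outcome and
in the weighted mixed actions. Against any fixed mixed actions, the outcome that plays them has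
regret zero. If no outcome had all regrets at most `ε`, the bilinear game would have no value.
Finite-dimensional separation and a greedy choice would then give an infinite threshold pattern
(`exists_threshold_of_gap`). Iterated ultrafilter limits confine such a pattern to one player
(`not_threshold_sum`, `iterated_limit_le`). Binary search along thresholds forces a signed sum
linear in the depth, so the Rademacher complexity could not vanish (`Forces.of_threshold`,
`not_threshold_of_tendsto`).

For finite fat-shattering dimension, a Littlestone-type recursion bounds the exponential moment of
the signed sums, with a factor polynomial in the depth (`expMoment_le`). For binary classes a
fat-shattered tree is already a Littlestone tree (`seqFatDim_le_littlestoneDim`). -/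

open scoped Pointwise

noncomputable section

namespace SeqGame

/-! ### Mixed actions as functionals. -/

/-- The evaluation functionals on real functions on `Z`. -/
def evals (Z : Type*) : Set (Module.Dual ℝ (Z → ℝ)) :=
  Set.range fun a => (LinearMap.proj a : (Z → ℝ) →ₗ[ℝ] ℝ)

/-- The finitely supported mixed actions, as functionals on real functions. -/
def mixed (Z : Type*) : Set (Module.Dual ℝ (Z → ℝ)) := convexHull ℝ (evals Z)

theorem convex_mixed (Z : Type*) : Convex ℝ (mixed Z) := convex_convexHull ℝ _

theorem proj_mem_mixed {Z : Type*} (a : Z) :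
    (LinearMap.proj a : (Z → ℝ) →ₗ[ℝ] ℝ) ∈ mixed Z :=
  subset_convexHull ℝ _ ⟨a, rfl⟩

theorem mixed_nonempty (Z : Type*) [Nonempty Z] : (mixed Z).Nonempty :=
  ⟨_, proj_mem_mixed (Classical.arbitrary Z)⟩

theorem mixed_le {Z : Type*} {p : Module.Dual ℝ (Z → ℝ)} (hp : p ∈ mixed Z) {x : Z → ℝ} {c : ℝ}
    (hx : ∀ a, x a ≤ c) : p x ≤ c := by
  have : mixed Z ⊆ {p | p x ≤ c} := by
    refine convexHull_min ?_ ?_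
    · rintro _ ⟨a, rfl⟩
      exact hx a
    · intro p hp q hq α β hα hβ hab
      simp only [Set.mem_ofPred_eq, LinearMap.add_apply, LinearMap.smul_apply, smul_eq_mul] at *
      calc α * p x + β * q x ≤ α * c + β * c := by gcongr
        _ = c := by rw [← add_mul, hab, one_mul]
  exact this hp

theorem le_mixed {Z : Type*} {p : Module.Dual ℝ (Z → ℝ)} (hp : p ∈ mixed Z) {x : Z → ℝ} {c : ℝ}
    (hx : ∀ a, c ≤ x a) : c ≤ p x := by
  have := mixed_le hp (x := -x) (c := -c) (fun a => by simpa using hx a)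
  rw [map_neg] at this
  linarith

theorem mixed_const {Z : Type*} {p : Module.Dual ℝ (Z → ℝ)} (hp : p ∈ mixed Z) (c : ℝ) :
    p (fun _ => c) = c :=
  le_antisymm (mixed_le hp fun _ => le_rfl) (le_mixed hp fun _ => le_rfl)

theorem abs_mixed_le {Z : Type*} {p : Module.Dual ℝ (Z → ℝ)} (hp : p ∈ mixed Z) {x : Z → ℝ}
    {c : ℝ} (hx : ∀ a, |x a| ≤ c) : |p x| ≤ c :=
  abs_le.2 ⟨le_mixed hp fun a => (abs_le.1 (hx a)).1, mixed_le hp fun a => (abs_le.1 (hx a)).2⟩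

theorem abs_le_of_mem_convexHull {Z : Type*} {H : Set (Z → ℝ)} {B : ℝ}
    (hB : ∀ h ∈ H, ∀ a, |h a| ≤ B) {q : Z → ℝ} (hq : q ∈ convexHull ℝ H) (a : Z) : |q a| ≤ B := by
  have : convexHull ℝ H ⊆ {q | |q a| ≤ B} := by
    refine convexHull_min (fun h hh => hB h hh a) ?_
    intro p hp q hq α β hα hβ hab
    simp only [Set.mem_ofPred_eq, abs_le, Pi.add_apply, Pi.smul_apply, smul_eq_mul] at *
    constructor <;> nlinarith
  exact this hq

/-! ### Forced signed sums, with mixed nodes and mixed functions. -/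

/-- `Forces H T c v`: with offset `c`, a tree of depth `T` and a selection from `H` along its
branches reach an expected signed sum of at least `v`. -/
def Forces {Z : Type*} (H : Set (Z → ℝ)) : ℕ → Module.Dual ℝ (Z → ℝ) → ℝ → Prop
  | 0, c, v => ∃ h ∈ H, v ≤ c h
  | T + 1, c, v => ∃ (a : Z) (v₁ v₂ : ℝ), Forces H T (c + LinearMap.proj a) v₁ ∧
      Forces H T (c - LinearMap.proj a) v₂ ∧ v ≤ (v₁ + v₂) / 2

namespace Forces

variable {Z : Type*} {H : Set (Z → ℝ)}

theorem mono {T : ℕ} {c : Module.Dual ℝ (Z → ℝ)} {v w : ℝ} (h : Forces H T c v) (hw : w ≤ v) :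
    Forces H T c w := by
  cases T with
  | zero =>
    obtain ⟨x, hx, hv⟩ := h
    exact ⟨x, hx, hw.trans hv⟩
  | succ T =>
    obtain ⟨a, v₁, v₂, h₁, h₂, hv⟩ := h
    exact ⟨a, v₁, v₂, h₁, h₂, hw.trans hv⟩

/-- Convexity of the optimal value in the offset, at the level of witnesses: the same tree and
selection serve both offsets, and their signed sums are affine in the offset. -/
theorem split {T : ℕ} {c₁ c₂ : Module.Dual ℝ (Z → ℝ)} {α β v : ℝ} (hab : α + β = 1)
    (h : Forces H T (α • c₁ + β • c₂) v) :
    ∃ v₁ v₂, Forces H T c₁ v₁ ∧ Forces H T c₂ v₂ ∧ v ≤ α * v₁ + β * v₂ := by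
  induction T generalizing c₁ c₂ v with
  | zero =>
    obtain ⟨x, hx, hv⟩ := h
    exact ⟨c₁ x, c₂ x, ⟨x, hx, le_rfl⟩, ⟨x, hx, le_rfl⟩, by simpa using hv⟩
  | succ T ih =>
    obtain ⟨a, u, w, hu, hw, hv⟩ := h
    have e₁ : α • c₁ + β • c₂ + (LinearMap.proj a : (Z → ℝ) →ₗ[ℝ] ℝ) =
        α • (c₁ + LinearMap.proj a) + β • (c₂ + LinearMap.proj a) := by
      rw [smul_add, smul_add, add_add_add_comm, ← add_smul, hab, one_smul]
    have e₂ : α • c₁ + β • c₂ - (LinearMap.proj a : (Z → ℝ) →ₗ[ℝ] ℝ) =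
        α • (c₁ - LinearMap.proj a) + β • (c₂ - LinearMap.proj a) := by
      rw [smul_sub, smul_sub, sub_add_sub_comm, ← add_smul, hab, one_smul]
    rw [e₁] at hu
    rw [e₂] at hw
    obtain ⟨u₁, u₂, hu₁, hu₂, hu⟩ := ih hu
    obtain ⟨w₁, w₂, hw₁, hw₂, hw⟩ := ih hw
    exact ⟨(u₁ + w₁) / 2, (u₂ + w₂) / 2, ⟨a, u₁, w₁, hu₁, hw₁, le_rfl⟩,
      ⟨a, u₂, w₂, hu₂, hw₂, le_rfl⟩, by linarith⟩

theorem of_mem_convexHull {c : Module.Dual ℝ (Z → ℝ)} {q : Z → ℝ} (hq : q ∈ convexHull ℝ H) :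
    Forces H 0 c (c q) := by
  obtain ⟨x, hx, hv⟩ := (c.convexOn convex_univ).exists_ge_of_mem_convexHull (Set.subset_univ _) hq
  exact ⟨x, hx, hv⟩

/-- The average of the values at `c + p` and `c - p` is convex in `p`, so some pure action does at
least as well as a mixed one. -/
theorem of_mixed {T : ℕ} {p : Module.Dual ℝ (Z → ℝ)} (hp : p ∈ mixed Z)
    {c : Module.Dual ℝ (Z → ℝ)} {v₁ v₂ : ℝ} (h₁ : Forces H T (c + p) v₁)
    (h₂ : Forces H T (c - p) v₂) : Forces H (T + 1) c ((v₁ + v₂) / 2) := by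
  have : mixed Z ⊆ {p | ∀ v₁ v₂, Forces H T (c + p) v₁ → Forces H T (c - p) v₂ →
      Forces H (T + 1) c ((v₁ + v₂) / 2)} := by
    refine convexHull_min ?_ ?_
    · rintro _ ⟨a, rfl⟩ v₁ v₂ h₁ h₂
      exact ⟨a, v₁, v₂, h₁, h₂, le_rfl⟩
    · intro p hp q hq α β hα hβ hab v₁ v₂ h₁ h₂
      have e₁ : c + (α • p + β • q) = α • (c + p) + β • (c + q) := by
        rw [smul_add, smul_add, add_add_add_comm, ← add_smul, hab, one_smul]
      have e₂ : c - (α • p + β • q) = α • (c - p) + β • (c - q) := by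
        rw [smul_sub, smul_sub, sub_add_sub_comm, ← add_smul, hab, one_smul]
      rw [e₁] at h₁
      rw [e₂] at h₂
      obtain ⟨u₁, u₂, hu₁, hu₂, hu⟩ := split hab h₁
      obtain ⟨w₁, w₂, hw₁, hw₂, hw⟩ := split hab h₂
      by_cases hc : (v₁ + v₂) / 2 ≤ (u₁ + w₁) / 2
      · exact (hp _ _ hu₁ hw₁).mono hc
      by_cases hc' : (v₁ + v₂) / 2 ≤ (u₂ + w₂) / 2
      · exact (hq _ _ hu₂ hw₂).mono hc'
      exfalso
      push Not at hc hc'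
      have k₁ : α * ((u₁ + w₁) / 2) + β * ((u₂ + w₂) / 2) < (v₁ + v₂) / 2 := by
        rcases hα.lt_or_eq with h | h
        · have l₁ := mul_lt_mul_of_pos_left hc h
          have l₂ := mul_le_mul_of_nonneg_left hc'.le hβ
          have l₃ : α * ((v₁ + v₂) / 2) + β * ((v₁ + v₂) / 2) = (v₁ + v₂) / 2 := by
            rw [← add_mul, hab, one_mul]
          linarith
        · have : β = 1 := by linarith
          subst h this
          linarith
      linarith
  exact this hp _ _ h₁ h₂

/-- Binary search on the `2 ^ T` consecutive functions from `q l` on: each query separates the two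
halves by `δ`, which adds `δ / 2` to the expected signed sum. -/
theorem of_threshold {p : ℕ → Module.Dual ℝ (Z → ℝ)} {q : ℕ → Z → ℝ} (hp : ∀ i, p i ∈ mixed Z)
    (hq : ∀ i, q i ∈ convexHull ℝ H) {r δ : ℝ} (hi : ∀ i k, k ≤ i → r + δ ≤ p i (q k))
    (lo : ∀ i k, i < k → p i (q k) ≤ r) (T l : ℕ) (c : Module.Dual ℝ (Z → ℝ)) :
    Forces H T c ((∑ k ∈ Finset.range (2 ^ T), c (q (l + k))) / 2 ^ T + T * δ / 2) := by
  induction T generalizing l c with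
  | zero =>
    refine (of_mem_convexHull (c := c) (hq l)).mono ?_
    simp
  | succ T ih =>
    have hpos : (0 : ℕ) < 2 ^ T := by positivity
    -- The last index of the left half: `p N` is at least `r + δ` there and at most `r` on the right
    -- half. Sign `+` continues left, sign `-` right.
    set N := l + 2 ^ T - 1 with hN
    refine (of_mixed (hp N) (ih l _) (ih (l + 2 ^ T) _)).mono ?_
    rw [pow_succ, mul_two, Finset.sum_range_add]
    simp only [LinearMap.add_apply, LinearMap.sub_apply, Finset.sum_add_distrib,
      Finset.sum_sub_distrib, ← add_assoc]
    have a₁ : (2 ^ T : ℝ) * (r + δ) ≤ ∑ k ∈ Finset.range (2 ^ T), p N (q (l + k)) := by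
      have := Finset.card_nsmul_le_sum (Finset.range (2 ^ T)) (fun k => p N (q (l + k))) (r + δ)
        (fun k hk => hi _ _ (by have := Finset.mem_range.1 hk; omega))
      simpa only [Finset.card_range, nsmul_eq_mul, Nat.cast_pow, Nat.cast_ofNat] using this
    have a₂ : ∑ k ∈ Finset.range (2 ^ T), p N (q (l + 2 ^ T + k)) ≤ (2 ^ T : ℝ) * r := by
      have := Finset.sum_le_card_nsmul (Finset.range (2 ^ T)) (fun k => p N (q (l + 2 ^ T + k))) r
        (fun k hk => lo _ _ (by omega))
      simpa using this
    have h2 : (0 : ℝ) < 2 ^ T := by positivity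
    push_cast
    set X := ∑ k ∈ Finset.range (2 ^ T), p N (q (l + k))
    set Y := ∑ k ∈ Finset.range (2 ^ T), p N (q (l + 2 ^ T + k))
    have key : δ ≤ (X - Y) / 2 ^ T := by
      rw [le_div_iff₀ h2]
      linarith
    rw [sub_div] at key
    rw [pow_succ, ← div_div]
    simp only [add_div, sub_div]
    linarith

end Forces

/-! ### Trees, branches and the sequential Rademacher complexity. -/

/-- The subtree of a tree below the child `b` of the root. -/
def BTree.sub {Z : Type*} {d : ℕ} (z : BTree Z (d + 1)) (b : Bool) : BTree Z d :=
  fun t p => z t.succ (Fin.cons b p : Fin (t + 1) → Bool)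

/-- The tree with root label `a` and subtrees `w b`. -/
def BTree.node {Z : Type*} {d : ℕ} (a : Z) (w : Bool → BTree Z d) : BTree Z (d + 1) :=
  fun t => Fin.cases (motive := fun t => (Fin t → Bool) → Z) (fun _ => a)
    (fun t p => w (p ⟨0, Nat.succ_pos _⟩) t (fun i => p i.succ)) t

theorem BTree.along_zero {Z : Type*} {d : ℕ} (z : BTree Z (d + 1)) (ε : Fin (d + 1) → Bool) :
    z.along ε 0 = z 0 Fin.elim0 := by
  unfold BTree.along
  congr 1
  funext i
  exact i.elim0

theorem BTree.along_cons_succ {Z : Type*} {d : ℕ} (z : BTree Z (d + 1)) (b : Bool)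
    (ε : Fin d → Bool) (t : Fin d) :
    z.along (Fin.cons b ε : Fin (d + 1) → Bool) t.succ = (z.sub b).along ε t := by
  unfold BTree.along BTree.sub
  congr 1
  funext i
  refine Fin.cases ?_ (fun i => ?_) i
  · rfl
  · rfl

theorem BTree.node_zero {Z : Type*} {d : ℕ} (a : Z) (w : Bool → BTree Z d) (p : Fin 0 → Bool) :
    BTree.node a w 0 p = a := rfl

theorem BTree.sub_node {Z : Type*} {d : ℕ} (a : Z) (w : Bool → BTree Z d) (b : Bool) :
    (BTree.node a w).sub b = w b := by
  funext t p
  rfl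

theorem sum_signs_succ {M : Type*} [AddCommMonoid M] (T : ℕ) (f : (Fin (T + 1) → Bool) → M) :
    ∑ ε, f ε = ∑ ε : Fin T → Bool, f (Fin.cons true ε) +
      ∑ ε : Fin T → Bool, f (Fin.cons false ε) := by
  rw [← (Fin.consEquiv (fun _ : Fin (T + 1) => Bool)).sum_comp, Fintype.sum_prod_type]
  simp [Fin.consEquiv]

theorem sgn_true : sgn true = 1 := rfl

theorem sgn_false : sgn false = -1 := by simp [sgn]

theorem abs_sgn (b : Bool) : |sgn b| = 1 := by cases b <;> simp [sgn]

theorem Forces.exists_tree {Z : Type*} {H : Set (Z → ℝ)} {T : ℕ} {c : Module.Dual ℝ (Z → ℝ)}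
    {v : ℝ} (hv : Forces H T c v) : ∃ (z : BTree Z T) (h : (Fin T → Bool) → Z → ℝ),
      (∀ ε, h ε ∈ H) ∧
      v ≤ (∑ ε, (c (h ε) + ∑ t, sgn (ε t) * h ε (z.along ε t))) / 2 ^ T := by
  induction T generalizing c v with
  | zero =>
    obtain ⟨x, hx, hv⟩ := hv
    exact ⟨fun t => t.elim0, fun _ => x, fun _ => hx, by simpa using hv⟩
  | succ T ih =>
    obtain ⟨a, v₁, v₂, h₁, h₂, hv⟩ := hv
    obtain ⟨z₁, s₁, hs₁, h₁⟩ := ih h₁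
    obtain ⟨z₂, s₂, hs₂, h₂⟩ := ih h₂
    refine ⟨BTree.node a fun b => cond b z₁ z₂,
      fun ε => cond (ε 0) (s₁ (Fin.tail ε)) (s₂ (Fin.tail ε)), fun ε => ?_, ?_⟩
    · dsimp only
      cases ε 0
      · exact hs₂ _
      · exact hs₁ _
    · rw [sum_signs_succ]
      simp only [Fin.sum_univ_succ, BTree.along_zero, BTree.node_zero, Fin.cons_zero, Fin.cons_succ,
        BTree.along_cons_succ, BTree.sub_node, cond_true, cond_false, Fin.tail_cons, sgn_true,
        sgn_false]
      have e₁ : ∀ ε, (c + (LinearMap.proj a : (Z → ℝ) →ₗ[ℝ] ℝ)) (s₁ ε) = c (s₁ ε) + s₁ ε a :=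
        fun _ => rfl
      have e₂ : ∀ ε, (c - (LinearMap.proj a : (Z → ℝ) →ₗ[ℝ] ℝ)) (s₂ ε) = c (s₂ ε) - s₂ ε a :=
        fun _ => rfl
      simp only [e₁] at h₁
      simp only [e₂] at h₂
      refine hv.trans ((div_le_div_of_nonneg_right (add_le_add h₁ h₂) zero_le_two).trans_eq ?_)
      rw [← add_div, div_div, pow_succ]
      congr 2
      · exact Finset.sum_congr rfl fun ε _ => by ring
      · exact Finset.sum_congr rfl fun ε _ => by ring

section Rademacher

variable {Z : Type*} {H : Set (Z → ℝ)} {B : ℝ}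

theorem abs_signedSum_le (hB : ∀ h ∈ H, ∀ a, |h a| ≤ B) {h : Z → ℝ} (hh : h ∈ H) {T : ℕ}
    (z : BTree Z T) (ε : Fin T → Bool) :
    |(1 / (T : ℝ)) * ∑ t : Fin T, sgn (ε t) * h (z.along ε t)| ≤ |B| := by
  have h1 : |∑ t : Fin T, sgn (ε t) * h (z.along ε t)| ≤ T * |B| := by
    refine (Finset.abs_sum_le_sum_abs _ _).trans ?_
    refine (Finset.sum_le_card_nsmul _ _ |B| fun t _ => ?_).trans_eq (by simp)
    rw [abs_mul, abs_sgn, one_mul]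
    exact (hB h hh _).trans (le_abs_self B)
  rcases T.eq_zero_or_pos with rfl | hT
  · simp
  · have : (0 : ℝ) < T := by exact_mod_cast hT
    rw [abs_mul, abs_of_nonneg (by positivity), one_div, inv_mul_le_iff₀ this]
    exact h1

theorem bddAbove_signedSum (hB : ∀ h ∈ H, ∀ a, |h a| ≤ B) {T : ℕ} (z : BTree Z T)
    (ε : Fin T → Bool) : BddAbove (Set.range fun h : H =>
      (1 / (T : ℝ)) * ∑ t : Fin T, sgn (ε t) * (h : Z → ℝ) (z.along ε t)) := by
  refine ⟨|B|, ?_⟩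
  rintro _ ⟨h, rfl⟩
  exact (le_abs_self _).trans (abs_signedSum_le hB h.2 z ε)

theorem bddAbove_treeValue [Nonempty H] (hB : ∀ h ∈ H, ∀ a, |h a| ≤ B) (T : ℕ) :
    BddAbove (Set.range fun z : BTree Z T => (∑ ε : Fin T → Bool,
      ⨆ h : H, (1 / (T : ℝ)) * ∑ t : Fin T, sgn (ε t) * (h : Z → ℝ) (z.along ε t)) / 2 ^ T) := by
  refine ⟨|B|, ?_⟩
  rintro _ ⟨z, rfl⟩
  have : ∑ ε : Fin T → Bool,
      (⨆ h : H, (1 / (T : ℝ)) * ∑ t : Fin T, sgn (ε t) * (h : Z → ℝ) (z.along ε t)) ≤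
      2 ^ T * |B| := by
    refine (Finset.sum_le_card_nsmul _ _ |B| fun ε _ => ?_).trans_eq (by simp)
    exact ciSup_le fun h => (le_abs_self _).trans (abs_signedSum_le hB h.2 z ε)
  rw [div_le_iff₀ (by positivity)]
  linarith

theorem le_seqRademacher (hB : ∀ h ∈ H, ∀ a, |h a| ≤ B) {T : ℕ} (z : BTree Z T)
    (h : (Fin T → Bool) → Z → ℝ) (hh : ∀ ε, h ε ∈ H) :
    (∑ ε, (1 / (T : ℝ)) * ∑ t, sgn (ε t) * h ε (z.along ε t)) / 2 ^ T ≤ seqRademacher H T := by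
  have : Nonempty H := ⟨⟨h fun _ => true, hh _⟩⟩
  refine le_trans ?_ (le_ciSup (bddAbove_treeValue hB T) z)
  refine div_le_div_of_nonneg_right (Finset.sum_le_sum fun ε _ => ?_) (by positivity)
  exact le_ciSup (bddAbove_signedSum hB z ε) ⟨h ε, hh ε⟩

theorem Forces.le_seqRademacher (hB : ∀ h ∈ H, ∀ a, |h a| ≤ B) {T : ℕ} {v : ℝ}
    (hv : Forces H T 0 v) : (1 / (T : ℝ)) * v ≤ seqRademacher H T := by
  obtain ⟨z, h, hh, hv⟩ := hv.exists_tree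
  refine le_trans ?_ (SeqGame.le_seqRademacher hB z h hh)
  rw [← Finset.mul_sum, mul_div_assoc]
  refine mul_le_mul_of_nonneg_left ?_ (by positivity)
  simpa using hv

theorem seqRademacher_nonneg [Nonempty Z] (hH : H.Nonempty) (hB : ∀ h ∈ H, ∀ a, |h a| ≤ B)
    (T : ℕ) : 0 ≤ seqRademacher H T := by
  have a : Z := Classical.arbitrary Z
  obtain ⟨h, hh⟩ := hH
  have key : ∀ T, Forces H T 0 0 := by
    intro T
    have aux : ∀ (T : ℕ) (c : Module.Dual ℝ (Z → ℝ)), Forces H T c (c h) := by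
      intro T
      induction T with
      | zero => exact fun c => ⟨h, hh, le_rfl⟩
      | succ T ih => exact fun c => ⟨a, _, _, ih _, ih _, by simp⟩
    simpa using aux T 0
  simpa using (key T).le_seqRademacher hB

/-- A class of vanishing sequential Rademacher complexity has no infinite threshold pattern, even
for mixed actions and mixtures of its members. -/
theorem not_threshold_of_tendsto (hB : ∀ h ∈ H, ∀ a, |h a| ≤ B)
    (hR : Tendsto (seqRademacher H) atTop (𝓝 0)) {p : ℕ → Module.Dual ℝ (Z → ℝ)}
    {q : ℕ → Z → ℝ} (hp : ∀ i, p i ∈ mixed Z) (hq : ∀ i, q i ∈ convexHull ℝ H) {r s : ℝ}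
    (hrs : r < s) (hi : ∀ i k, k ≤ i → s ≤ p i (q k)) (lo : ∀ i k, i < k → p i (q k) ≤ r) :
    False := by
  have key : ∀ T : ℕ, 0 < T → (s - r) / 2 ≤ seqRademacher H T := by
    intro T hT
    have hT' : (0 : ℝ) < T := by exact_mod_cast hT
    have := (Forces.of_threshold (r := r) (δ := s - r) hp hq (by simpa using hi) lo T 0
      0).le_seqRademacher hB
    refine le_trans (le_of_eq ?_) this
    simp
    field_simp
  have : (s - r) / 2 ≤ 0 :=
    ge_of_tendsto hR (eventually_atTop.2 ⟨1, fun T hT => key T hT⟩)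
  linarith

end Rademacher

/-! ### Threshold patterns and iterated limits. -/

theorem exists_tendsto_hyperfilter {f : ℕ → ℝ} {B : ℝ} (hf : ∀ n, |f n| ≤ B) :
    ∃ a, |a| ≤ B ∧ Tendsto f (hyperfilter ℕ) (𝓝 a) := by
  obtain ⟨a, ha, h⟩ := (isCompact_Icc (a := -B) (b := B)).ultrafilter_le_nhds'
    (Ultrafilter.map f (hyperfilter ℕ)) (Ultrafilter.mem_map.2 (Filter.univ_mem' fun n => abs_le.1 (hf n)))
  exact ⟨a, abs_le.2 ha, h⟩

/-- If a double sequence has no threshold pattern, its iterated limits are ordered. -/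
theorem iterated_limit_le {F : ℕ → ℕ → ℝ}
    (hF : ∀ (φ ψ : ℕ → ℕ) (r s : ℝ), r < s → (∀ i k, k ≤ i → s ≤ F (φ i) (ψ k)) →
      (∀ i k, i < k → F (φ i) (ψ k) ≤ r) → False)
    {a b : ℕ → ℝ} {α β : ℝ} (ha : ∀ N, Tendsto (F N) (hyperfilter ℕ) (𝓝 (a N)))
    (hα : Tendsto a (hyperfilter ℕ) (𝓝 α))
    (hb : ∀ n, Tendsto (fun N => F N n) (hyperfilter ℕ) (𝓝 (b n)))
    (hβ : Tendsto b (hyperfilter ℕ) (𝓝 β)) : β ≤ α := by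
  by_contra! hlt
  obtain ⟨r, har, hrb⟩ := exists_between hlt
  obtain ⟨s, hrs, hsb⟩ := exists_between hrb
  obtain ⟨f, hf, hf'⟩ := exists_seq_of_forall_finset_exists
    (fun x : ℕ × ℕ => a x.1 < r ∧ s < b x.2 ∧ s < F x.1 x.2)
    (fun x y => F x.1 y.2 < r ∧ s < F y.1 x.2) (by
      intro S hS
      -- The column `n` comes first, low on all earlier rows; then a row `N` that is high on all
      -- earlier columns and on `n` itself.
      have h1 : ∀ᶠ n in (hyperfilter ℕ : Filter ℕ), s < b n ∧ ∀ x ∈ S, F x.1 n < r :=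
        (hβ.eventually_const_lt hsb).and ((Finset.eventually_all S).2 fun x hx =>
          (ha x.1).eventually_lt_const (hS x hx).1)
      obtain ⟨n, hn, hnS⟩ := h1.exists
      have h2 : ∀ᶠ N in (hyperfilter ℕ : Filter ℕ), a N < r ∧ s < F N n ∧ ∀ x ∈ S, s < F N x.2 :=
        (hα.eventually_lt_const har).and (((hb n).eventually_const_lt hn).and
          ((Finset.eventually_all S).2 fun x hx => (hb x.2).eventually_const_lt (hS x hx).2.1))
      obtain ⟨N, hN, hNn, hNS⟩ := h2.exists
      exact ⟨(N, n), ⟨hN, hn, hNn⟩, fun x hx => ⟨hnS x hx, hNS x hx⟩⟩)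
  refine hF (fun i => (f i).1) (fun i => (f i).2) r s hrs ?_ ?_
  · intro i k hki
    rcases hki.lt_or_eq with h | rfl
    · exact (hf' _ _ h).2.le
    · exact (hf _).2.2.le
  · intro i k hik
    exact (hf' _ _ hik).1.le

/-- Weighted finite sums of double sequences without threshold patterns, up to offsets that depend
on one index only, have no threshold pattern. -/
theorem not_threshold_sum {ι : Type*} [Fintype ι] {F : ι → ℕ → ℕ → ℝ} {w c : ι → ℕ → ℝ} {B : ℝ}
    (hFB : ∀ j N n, |F j N n| ≤ B) (hw : ∀ j N, |w j N| ≤ 1) (hw0 : ∀ j N, 0 ≤ w j N)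
    (hc : ∀ j n, |c j n| ≤ B)
    (hF : ∀ j (φ ψ : ℕ → ℕ) (r s : ℝ), r < s → (∀ i k, k ≤ i → s ≤ F j (φ i) (ψ k)) →
      (∀ i k, i < k → F j (φ i) (ψ k) ≤ r) → False) {u v : ℝ} (huv : u < v)
    (hi : ∀ N n, n ≤ N → v ≤ ∑ j, w j N * (F j N n - c j n))
    (lo : ∀ N n, N < n → ∑ j, w j N * (F j N n - c j n) ≤ u) : False := by
  choose W hWB hW using fun j => exists_tendsto_hyperfilter (hw j)
  choose C hCB hC using fun j => exists_tendsto_hyperfilter (hc j)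
  choose a haB ha using fun j N => exists_tendsto_hyperfilter (hFB j N)
  choose b hbB hb using fun j n => exists_tendsto_hyperfilter (f := fun N => F j N n)
    (fun N => hFB j N n)
  choose α hαB hα using fun j => exists_tendsto_hyperfilter (haB j)
  choose β hβB hβ using fun j => exists_tendsto_hyperfilter (hbB j)
  have hW0 : ∀ j, 0 ≤ W j := fun j => ge_of_tendsto' (hW j) (hw0 j)
  have hle : ∀ j, β j ≤ α j := fun j => iterated_limit_le (hF j) (ha j) (hα j) (hb j) (hβ j)
  have hev : ∀ N : ℕ, ∀ᶠ n in (hyperfilter ℕ : Filter ℕ), N < n := fun N =>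
    (Nat.hyperfilter_le_atTop) (eventually_gt_atTop N)
  -- The limit in `n` before `N` sees only pairs `N < n`; the opposite order, in `h2`, sees only `n
  -- < N`. Weights and offsets have the same limits in both orders.
  have h1 : ∑ j, W j * (α j - C j) ≤ u := by
    refine le_of_tendsto (tendsto_finsetSum _ fun j _ => (hW j).mul ((hα j).sub_const (C j)))
      (Eventually.of_forall fun N => ?_)
    exact le_of_tendsto (tendsto_finsetSum _ fun j _ => ((ha j N).sub (hC j)).const_mul (w j N))
      ((hev N).mono fun n hn => lo N n hn)
  have h2 : v ≤ ∑ j, W j * (β j - C j) := by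
    refine ge_of_tendsto (tendsto_finsetSum _ fun j _ => ((hβ j).sub (hC j)).const_mul (W j))
      (Eventually.of_forall fun n => ?_)
    exact ge_of_tendsto (tendsto_finsetSum _ fun j _ => (hW j).mul ((hb j n).sub_const (c j n)))
      ((hev n).mono fun N hN => hi N n hN.le)
  have h3 : ∑ j, W j * (β j - C j) ≤ ∑ j, W j * (α j - C j) :=
    Finset.sum_le_sum fun j _ => mul_le_mul_of_nonneg_left (by linarith [hle j]) (hW0 j)
  linarith

/-! ### Minimax by separation, and patterns from a gap. -/

/-- A convex set in `ℝ^ι` on which every weighted average exceeds `v` somewhere has a point all of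
whose coordinates exceed `v`. -/
theorem exists_forall_lt_of_convex {ι : Type*} [Fintype ι] {C : Set (ι → ℝ)} (hC : Convex ℝ C)
    (hne : C.Nonempty) {v : ℝ}
    (h : ∀ w ∈ stdSimplex ℝ ι, ∃ y ∈ C, v < ∑ i, w i * y i) : ∃ y ∈ C, ∀ i, v < y i := by
  classical
  by_contra! hcon
  have hopen : IsOpen {y : ι → ℝ | ∀ i, v < y i} := by
    simp only [Set.ofPred_forall]
    exact isOpen_iInter_of_finite fun i => isOpen_lt continuous_const (continuous_apply i)
  have hconv : Convex ℝ {y : ι → ℝ | ∀ i, v < y i} := by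
    simp only [Set.ofPred_forall]
    exact convex_iInter fun i =>
      convex_halfSpace_gt (LinearMap.proj (R := ℝ) (φ := fun _ : ι => ℝ) i).isLinear v
  obtain ⟨f, u, hfs, hfC⟩ := geometric_hahn_banach_open hconv hopen hC
    (Set.disjoint_left.2 fun y hy hyC => by
      obtain ⟨i, hi⟩ := hcon y hyC
      exact absurd (hy i) (not_lt.2 hi))
  have hfsum : ∀ y, f y = ∑ i, f (Pi.single i 1) * y i := by
    intro y
    conv_lhs => rw [pi_eq_sum_univ' y]
    simp [map_sum, mul_comm]
  have hneg : ∀ i, f (Pi.single i 1) ≤ 0 := by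
    intro i
    by_contra! hpos
    -- The open orthant is unbounded in direction `i`, where a positive coefficient would make `f`
    -- exceed `u`.
    have key : ∀ t : ℝ, 0 ≤ t → f (fun _ => v + 1) + t * f (Pi.single i 1) < u := by
      intro t ht
      have := hfs ((fun _ => v + 1) + t • Pi.single i 1) (by
        intro k
        have : 0 ≤ (t • (Pi.single i 1 : ι → ℝ)) k := by
          by_cases hk : k = i
          · subst hk; simpa using ht
          · simp [hk]
        simp only [Pi.add_apply]
        linarith)
      simpa using this
    have h0 := key 0 le_rfl
    have h1 := key ((u - f (fun _ => v + 1)) / f (Pi.single i 1))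
      (div_nonneg (by linarith) hpos.le)
    rw [div_mul_cancel₀ _ hpos.ne'] at h1
    linarith
  set W := ∑ i, -f (Pi.single i 1) with hWdef
  have hconst : ∀ t : ℝ, f (fun _ => t) = -W * t := by
    intro t
    rw [hfsum, ← Finset.sum_mul, hWdef, Finset.sum_neg_distrib, neg_neg]
  have hWpos : 0 < W := by
    have hW0 : 0 ≤ W := Finset.sum_nonneg fun i _ => by linarith [hneg i]
    refine hW0.lt_of_ne fun hW => ?_
    have hz : ∀ i, f (Pi.single i 1) = 0 := fun i => by
      have := (Finset.sum_eq_zero_iff_of_nonneg fun i _ => by linarith [hneg i]).1 hW.symm i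
        (Finset.mem_univ i)
      linarith
    obtain ⟨y, hy⟩ := hne
    have h1 := hfC y hy
    have h2 := hfs (fun _ => v + 1) fun _ => by linarith
    rw [hfsum] at h1 h2
    simp only [hz, zero_mul, Finset.sum_const_zero] at h1 h2
    linarith
  have hu : -W * v ≤ u := by
    refine le_of_forall_pos_lt_add fun η hη => ?_
    have := hfs (fun _ => v + η / W) fun _ => by have := div_pos hη hWpos; linarith
    rw [hconst] at this
    have e : W * (η / W) = η := mul_div_cancel₀ _ hWpos.ne'
    linarith
  obtain ⟨y, hy, hlt⟩ := h (fun i => -f (Pi.single i 1) / W)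
    ⟨fun i => div_nonneg (by linarith [hneg i]) hWpos.le, by rw [← Finset.sum_div, div_self hWpos.ne']⟩
  have h1 := hfC y hy
  have e : ∑ i, -f (Pi.single i 1) / W * y i = -f y / W := by
    rw [hfsum y, ← Finset.sum_neg_distrib, Finset.sum_div]
    exact Finset.sum_congr rfl fun i _ => by ring
  rw [e, lt_div_iff₀ hWpos] at hlt
  linarith

section Minimax

variable {E F : Type*} [AddCommGroup E] [Module ℝ E] [AddCommGroup F] [Module ℝ F]

/-- One response beats finitely many opponents at once: a weighted average of them is again in `G`,
so the finite-dimensional statement applies to the image of `P`. -/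
theorem exists_forall_lt_bilin {P : Set E} {G : Set F} (hP : Convex ℝ P) (hPne : P.Nonempty)
    (hG : Convex ℝ G) (f : E →ₗ[ℝ] F →ₗ[ℝ] ℝ) {v : ℝ} (h : ∀ g ∈ G, ∃ p ∈ P, v < f p g)
    (s : Finset F) (hs : ∀ g ∈ s, g ∈ G) : ∃ p ∈ P, ∀ g ∈ s, v < f p g := by
  let Φ : E →ₗ[ℝ] (s → ℝ) := LinearMap.pi fun g => f.flip g
  have hΦ : ∀ p g, Φ p g = f p g := fun _ _ => rfl
  obtain ⟨_, ⟨p, hp, rfl⟩, hlt⟩ := exists_forall_lt_of_convex (hP.linear_image Φ) (hPne.image Φ)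
    (v := v) (by
      intro w hw
      obtain ⟨p, hp, hlt⟩ := h (∑ g, w g • (g : F))
        (hG.sum_mem (fun g _ => hw.1 g) hw.2 fun g _ => hs g g.2)
      refine ⟨Φ p, ⟨p, hp, rfl⟩, ?_⟩
      simpa [hΦ] using hlt)
  exact ⟨p, hp, fun g hg => hlt ⟨g, hg⟩⟩

/-- If a bilinear game on convex sets has no value, there is an infinite threshold pattern. -/
theorem exists_threshold_of_gap {P : Set E} {G : Set F} (hP : Convex ℝ P) (hPne : P.Nonempty)
    (hG : Convex ℝ G) (f : E →ₗ[ℝ] F →ₗ[ℝ] ℝ) {u v : ℝ} (hv : ∀ g ∈ G, ∃ p ∈ P, v < f p g)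
    (hu : ∀ p ∈ P, ∃ g ∈ G, f p g < u) :
    ∃ (p : ℕ → E) (g : ℕ → F), (∀ n, p n ∈ P) ∧ (∀ n, g n ∈ G) ∧
      (∀ N n, n ≤ N → v ≤ f (p N) (g n)) ∧ ∀ N n, N < n → f (p N) (g n) ≤ u := by
  classical
  have hGne : G.Nonempty := by
    obtain ⟨p, hp⟩ := hPne
    obtain ⟨g, hg, -⟩ := hu p hp
    exact ⟨g, hg⟩
  obtain ⟨x, hx, hx'⟩ := exists_seq_of_forall_finset_exists
    (fun x : E × F => x.1 ∈ P ∧ x.2 ∈ G ∧ v < f x.1 x.2)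
    (fun x y => f x.1 y.2 < u ∧ v < f y.1 x.2) (by
      intro S hS
      -- `g` answers all earlier `p`; the next `p` then answers all earlier `g` and this one, which
      -- gives the diagonal.
      obtain ⟨g, hg, hgS⟩ := exists_forall_lt_bilin hG hGne hP (-f.flip) (v := -u)
        (fun p hp => by
          obtain ⟨g, hg, hlt⟩ := hu p hp
          exact ⟨g, hg, by simpa using hlt⟩) (S.image Prod.fst)
        (fun p hp => by
          obtain ⟨x, hx, rfl⟩ := Finset.mem_image.1 hp
          exact (hS x hx).1)
      obtain ⟨p, hp, hpS⟩ := exists_forall_lt_bilin hP hPne hG f hv (insert g (S.image Prod.snd))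
        (fun g' hg' => by
          rcases Finset.mem_insert.1 hg' with rfl | hg'
          · exact hg
          · obtain ⟨x, hx, rfl⟩ := Finset.mem_image.1 hg'
            exact (hS x hx).2.1)
      refine ⟨(p, g), ⟨hp, hg, hpS g (Finset.mem_insert_self _ _)⟩, fun x hx => ⟨?_, ?_⟩⟩
      · simpa using hgS x.1 (Finset.mem_image_of_mem _ hx)
      · exact hpS x.2 (Finset.mem_insert_of_mem (Finset.mem_image_of_mem _ hx)))
  refine ⟨fun n => (x n).1, fun n => (x n).2, fun n => (hx n).1, fun n => (hx n).2.1, ?_, ?_⟩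
  · intro N n h
    rcases h.lt_or_eq with h | rfl
    · exact (hx' _ _ h).2.le
    · exact (hx _).2.2.le
  · intro N n h
    exact (hx' _ _ h).1.le

end Minimax

/-! ### Finitely supported distributions and product weights. -/

theorem exists_weights_of_mem_mixed {Z : Type*} {p : Module.Dual ℝ (Z → ℝ)} (hp : p ∈ mixed Z) :
    ∃ (ι : Type) (_ : Fintype ι) (w : ι → ℝ) (a : ι → Z), (∀ i, 0 ≤ w i) ∧ ∑ i, w i = 1 ∧
      p = ∑ i, w i • (LinearMap.proj (a i) : (Z → ℝ) →ₗ[ℝ] ℝ) := by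
  obtain ⟨ι, hι, w, z, hw, hw1, hz, h⟩ := mem_convexHull_iff_exists_fintype.1 hp
  choose a ha using hz
  refine ⟨ι, hι, w, a, hw, hw1, ?_⟩
  rw [← h]
  exact Finset.sum_congr rfl fun i _ => by rw [← ha i]

theorem sum_weights_mul_proj {Z ι : Type*} [Fintype ι] (w : ι → ℝ) (a : ι → Z) (x : Z → ℝ) :
    (∑ i, w i • (LinearMap.proj (a i) : (Z → ℝ) →ₗ[ℝ] ℝ)) x = ∑ i, w i * x (a i) := by
  simp

theorem exists_pmf_of_mem_mixed {Z : Type*} {M : Module.Dual ℝ (Z → ℝ)} (hM : M ∈ mixed Z) :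
    ∃ μ : PMF Z, ∀ f, expect μ f = M f := by
  classical
  obtain ⟨ι, hι, w, a, hw, hw1, rfl⟩ := exists_weights_of_mem_mixed hM
  have hmem : ∀ i, a i ∈ Finset.univ.image a := fun i =>
    Finset.mem_image_of_mem a (Finset.mem_univ i)
  refine ⟨PMF.ofFinset (fun s => ∑ i, if a i = s then ENNReal.ofReal (w i) else 0)
    (Finset.univ.image a) ?_ ?_, fun f => ?_⟩
  · rw [Finset.sum_comm]
    simp only [Finset.sum_ite_eq, hmem, if_true]
    rw [← ENNReal.ofReal_sum_of_nonneg fun i _ => hw i, hw1, ENNReal.ofReal_one]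
  · intro s hs
    refine Finset.sum_eq_zero fun i _ => if_neg ?_
    rintro rfl
    exact hs (hmem i)
  · have hr : ∀ s, (∑ i, if a i = s then ENNReal.ofReal (w i) else 0).toReal =
        ∑ i, if a i = s then w i else 0 := by
      intro s
      rw [ENNReal.toReal_sum fun i _ => by split_ifs <;> simp]
      refine Finset.sum_congr rfl fun i _ => ?_
      split_ifs
      · exact ENNReal.toReal_ofReal (hw i)
      · simp
    simp only [expect, PMF.ofFinset_apply, hr]
    rw [tsum_eq_sum (s := Finset.univ.image a), sum_weights_mul_proj]
    · simp only [Finset.sum_mul, ite_mul, zero_mul]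
      rw [Finset.sum_comm]
      simp only [Finset.sum_ite_eq, hmem, if_true]
    · intro s hs
      rw [Finset.sum_eq_zero, zero_mul]
      intro i _
      refine if_neg ?_
      rintro rfl
      exact hs (hmem i)

/-- Resampling one coordinate of a product weight. -/
theorem sum_prod_weights_resample {J : Type*} [Fintype J] [DecidableEq J] {ι : J → Type*}
    [∀ j, Fintype (ι j)] (w : ∀ j, ι j → ℝ) (j : J) (hw : ∑ i, w j i = 1)
    (G : (∀ l, ι l) → ι j → ℝ) (hG : ∀ k i i', G (Function.update k j i') i = G k i) :
    ∑ k : ∀ l, ι l, (∏ l, w l (k l)) * G k (k j) =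
      ∑ i, w j i * ∑ k : ∀ l, ι l, (∏ l, w l (k l)) * G k i := by
  -- Exchanging a fresh draw with coordinate `j` is an involution that preserves the total weight.
  let e : (ι j × ∀ l, ι l) → (ι j × ∀ l, ι l) := fun x => (x.2 j, Function.update x.2 j x.1)
  have he : Function.Involutive e := by
    rintro ⟨i, k⟩
    simp [e]
  have hwt : ∀ (i : ι j) (k : ∀ l, ι l),
      w j (k j) * ∏ l, w l (Function.update k j i l) = w j i * ∏ l, w l (k l) := by
    intro i k
    rw [← Finset.mul_prod_erase Finset.univ (fun l => w l (k l)) (Finset.mem_univ j),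
      ← Finset.mul_prod_erase Finset.univ (fun l => w l (Function.update k j i l))
        (Finset.mem_univ j), Function.update_self]
    have : ∏ l ∈ Finset.univ.erase j, w l (Function.update k j i l) =
        ∏ l ∈ Finset.univ.erase j, w l (k l) :=
      Finset.prod_congr rfl fun l hl => by
        rw [Function.update_of_ne (Finset.ne_of_mem_erase hl)]
    rw [this]
    ring
  have h1 : ∑ i, w j i * ∑ k : ∀ l, ι l, (∏ l, w l (k l)) * G k i =
      ∑ x : ι j × ∀ l, ι l, w j x.1 * (∏ l, w l (x.2 l)) * G x.2 x.1 := by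
    rw [Fintype.sum_prod_type]
    refine Finset.sum_congr rfl fun i _ => ?_
    rw [Finset.mul_sum]
    exact Finset.sum_congr rfl fun k _ => by ring
  rw [h1, ← Equiv.sum_comp (he.toPerm e), Fintype.sum_prod_type, Finset.sum_comm]
  refine Finset.sum_congr rfl fun k _ => ?_
  simp only [Function.Involutive.coe_toPerm, e, hwt, hG]
  rw [← Finset.sum_mul, ← Finset.sum_mul, hw, one_mul]

/-! ### Swap regret along a tree of mixed actions. -/

section Game

variable {m : ℕ} {S : Fin m → Type*} {A : Fin m → (∀ i, S i) → ℝ}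

/-- The payoff of player `j` when deviating according to `π`. -/
def deviation (A : Fin m → (∀ i, S i) → ℝ) (j : Fin m) (π : S j → S j) : (∀ i, S i) → ℝ :=
  fun s => A j (Function.update s j (π (s j)))

theorem deviation_id (A : Fin m → (∀ i, S i) → ℝ) (j : Fin m) :
    deviation A j (fun a => a) = A j := by
  funext s
  simp [deviation]

/-- Independent mixed actions induce a mixed action profile, in which each player faces a mixture
of the functions of its class. -/
theorem exists_product {p : ∀ j, Module.Dual ℝ (S j → ℝ)} (hp : ∀ j, p j ∈ mixed (S j)) :
    ∃ M ∈ mixed (∀ i, S i), ∃ q : ∀ j, S j → ℝ, (∀ j, q j ∈ convexHull ℝ (playerClass A j)) ∧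
      ∀ (j : Fin m) (π : S j → S j), M (deviation A j π) = p j (fun a => q j (π a)) := by
  classical
  choose ι hι w a hw0 hw1 hpw using fun j => exists_weights_of_mem_mixed (hp j)
  have hW0 : ∀ k : ∀ l, ι l, 0 ≤ ∏ l, w l (k l) := fun k =>
    Finset.prod_nonneg fun l _ => hw0 l _
  have hW1 : ∑ k : ∀ l, ι l, ∏ l, w l (k l) = 1 := by
    have := Finset.prod_univ_sum (fun l => (Finset.univ : Finset (ι l))) w
    rw [Fintype.piFinset_univ] at this
    rw [← this]
    simp [hw1]
  refine ⟨∑ k : ∀ l, ι l, (∏ l, w l (k l)) •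
      (LinearMap.proj (fun l => a l (k l)) : ((∀ i, S i) → ℝ) →ₗ[ℝ] ℝ),
    (convex_mixed _).sum_mem (fun k _ => hW0 k) hW1 fun k _ => proj_mem_mixed _,
    fun j => ∑ k : ∀ l, ι l, (∏ l, w l (k l)) •
      fun b => A j (Function.update (fun l => a l (k l)) j b),
    fun j => (convex_convexHull ℝ _).sum_mem (fun k _ => hW0 k) hW1
      fun k _ => subset_convexHull ℝ _ ⟨_, rfl⟩, fun j π => ?_⟩
  rw [hpw j, sum_weights_mul_proj, sum_weights_mul_proj]
  simp only [Finset.sum_apply, Pi.smul_apply, smul_eq_mul]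
  refine sum_prod_weights_resample w j (hw1 j)
    (fun k i => A j (Function.update (fun l => a l (k l)) j (π (a j i)))) fun k i i' => ?_
  congr 1
  funext l
  by_cases h : l = j
  · subst h; simp
  · simp [h]

/-- The outcomes `(M, q, r)` of a tree of depth `d` below ancestors with total mixed action `P`:
`M` is the average profile, `q j` the average function met by player `j`, `r j` the average value
of player `j` at the top level, and the swap regret is controlled. -/
def outcomes (A : Fin m → (∀ i, S i) → ℝ) (B ε K : ℝ) (P : ∀ j, Module.Dual ℝ (S j → ℝ)) (d : ℝ) :
    Set (Module.Dual ℝ ((∀ i, S i) → ℝ) × (∀ j, S j → ℝ) × (Fin m → ℝ)) :=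
  {x | x.1 ∈ mixed (∀ i, S i) ∧ (∀ j, x.2.1 j ∈ convexHull ℝ (playerClass A j)) ∧
    (∀ j, |x.2.2 j| ≤ B) ∧ ∀ (j : Fin m) (π : S j → S j),
      K * (x.1 (deviation A j π) - x.1 (A j)) ≤
        P j (fun a => x.2.1 j (π a)) - P j (x.2.1 j) + d * ε - x.2.2 j + B}

/-- With `P` fixed the regret bound is affine in `(M, q, r)`. Convex combinations correspond to
averaging over sibling subtrees. -/
theorem convex_outcomes (A : Fin m → (∀ i, S i) → ℝ) (B ε K : ℝ)
    (P : ∀ j, Module.Dual ℝ (S j → ℝ)) (d : ℝ) : Convex ℝ (outcomes A B ε K P d) := by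
  rintro ⟨M, q, r⟩ ⟨hM, hq, hr, h⟩ ⟨M', q', r'⟩ ⟨hM', hq', hr', h'⟩ α β hα hβ hab
  refine ⟨convex_mixed _ hM hM' hα hβ hab,
    fun j => convex_convexHull ℝ _ (hq j) (hq' j) hα hβ hab, fun j => ?_, fun j π => ?_⟩
  · have := (convex_Icc (-B) B) (abs_le.1 (hr j)) (abs_le.1 (hr' j)) hα hβ hab
    exact abs_le.2 this
  · have h1 := mul_le_mul_of_nonneg_left (h j π) hα
    have h2 := mul_le_mul_of_nonneg_left (h' j π) hβ
    have e : P j (fun a => (α • q + β • q') j (π a)) =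
        α * P j (fun a => q j (π a)) + β * P j fun a => q' j (π a) := by
      rw [← smul_eq_mul, ← smul_eq_mul, ← map_smul, ← map_smul, ← map_add]
      rfl
    have hc : d * ε + B = α * (d * ε + B) + β * (d * ε + B) := by rw [← add_mul, hab, one_mul]
    change K * ((α * M (deviation A j π) + β * M' (deviation A j π)) -
      (α * M (A j) + β * M' (A j))) ≤ P j (fun a => (α • q + β • q') j (π a)) -
      P j (α • q j + β • q' j) + d * ε - (α * r j + β * r' j) + B
    rw [e, map_add, map_smul, map_smul, smul_eq_mul, smul_eq_mul]
    dsimp only at h1 h2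
    linarith

/-- The weighted mixed actions of the players. -/
def weighted (S : Fin m → Type*) : Set (∀ j, Module.Dual ℝ (S j → ℝ)) :=
  {θ | ∃ w ∈ stdSimplex ℝ (Fin m), ∀ j, θ j ∈ w j • mixed (S j)}

/-- Recording the product of weight and mixed action, not the pair, keeps the regret linear;
convexity then rests on `(a + b) • C = a • C + b • C` for convex `C` and `a, b ≥ 0`. -/
theorem convex_weighted (S : Fin m → Type*) : Convex ℝ (weighted S) := by
  rintro θ ⟨w, hw, hθ⟩ θ' ⟨w', hw', hθ'⟩ α β hα hβ hab
  refine ⟨α • w + β • w', convex_stdSimplex ℝ _ hw hw' hα hβ hab, fun j => ?_⟩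
  simp only [Pi.add_apply, Pi.smul_apply, smul_eq_mul]
  rw [(convex_mixed (S j)).add_smul (mul_nonneg hα (hw.1 j)) (mul_nonneg hβ (hw'.1 j)), mul_smul,
    mul_smul]
  exact Set.add_mem_add (Set.smul_mem_smul_set (hθ j)) (Set.smul_mem_smul_set (hθ' j))

theorem single_mem_weighted [∀ j, Nonempty (S j)] (j : Fin m) (a : S j) :
    Pi.single j (LinearMap.proj a : (S j → ℝ) →ₗ[ℝ] ℝ) ∈ weighted S := by
  classical
  refine ⟨Pi.single j 1, single_mem_stdSimplex ℝ j, fun l => ?_⟩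
  by_cases h : l = j
  · subst h
    simpa using proj_mem_mixed a
  · simp [h, Set.zero_smul_set (mixed_nonempty (S l))]

/-- The weighted external regret as a bilinear form. -/
def regretForm (S : Fin m → Type*) : (∀ j, Module.Dual ℝ (S j → ℝ)) →ₗ[ℝ]
    (Module.Dual ℝ ((∀ i, S i) → ℝ) × (∀ j, S j → ℝ) × (Fin m → ℝ)) →ₗ[ℝ] ℝ :=
  LinearMap.mk₂ ℝ (fun θ x => ∑ j, θ j (x.2.1 j - fun _ => x.2.2 j))
    (fun θ θ' x => by simp [Finset.sum_add_distrib])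
    (fun c θ x => by
      simp only [Pi.smul_apply, LinearMap.smul_apply, smul_eq_mul, Finset.mul_sum])
    (fun θ x y => by
      rw [← Finset.sum_add_distrib]
      refine Finset.sum_congr rfl fun j _ => ?_
      rw [← map_add]
      congr 1
      funext a
      simp only [Prod.snd_add, Prod.fst_add, Pi.add_apply, Pi.sub_apply]
      ring)
    (fun c θ x => by
      rw [smul_eq_mul, Finset.mul_sum]
      refine Finset.sum_congr rfl fun j _ => ?_
      rw [← smul_eq_mul, ← map_smul]
      congr 1
      funext a
      simp only [Prod.smul_snd, Prod.smul_fst, Pi.smul_apply, Pi.sub_apply, smul_eq_mul]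
      ring)

theorem regretForm_apply (θ : ∀ j, Module.Dual ℝ (S j → ℝ))
    (x : Module.Dual ℝ ((∀ i, S i) → ℝ) × (∀ j, S j → ℝ) × (Fin m → ℝ)) :
    regretForm S θ x = ∑ j, θ j (x.2.1 j - fun _ => x.2.2 j) := rfl

theorem regretForm_weighted {w : Fin m → ℝ} {p : ∀ j, Module.Dual ℝ (S j → ℝ)}
    (hp : ∀ j, p j ∈ mixed (S j))
    (x : Module.Dual ℝ ((∀ i, S i) → ℝ) × (∀ j, S j → ℝ) × (Fin m → ℝ)) :
    regretForm S (fun j => w j • p j) x = ∑ j, w j * (p j (x.2.1 j) - x.2.2 j) := by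
  rw [regretForm_apply]
  refine Finset.sum_congr rfl fun j _ => ?_
  rw [LinearMap.smul_apply, map_sub, mixed_const (hp j), smul_eq_mul]

theorem abs_playerClass_le {B : ℝ} (hB : ∀ j s, |A j s| ≤ B) (j : Fin m) :
    ∀ h ∈ playerClass A j, ∀ a, |h a| ≤ B := by
  rintro _ ⟨s, rfl⟩ a
  exact hB j _

theorem playerClass_nonempty [∀ j, Nonempty (S j)] (A : Fin m → (∀ i, S i) → ℝ) (j : Fin m) :
    (playerClass A j).Nonempty := Set.range_nonempty _

/-- Every tree depth has an outcome with small external regret at the top level. -/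
theorem exists_outcome [∀ j, Nonempty (S j)] {B : ℝ} (hB : ∀ j s, |A j s| ≤ B)
    (hR : ∀ j, Tendsto (seqRademacher (playerClass A j)) atTop (𝓝 0)) {ε : ℝ} (hε : 0 < ε)
    {K : ℕ} (hK : 0 < K) (d k : ℕ) (hk : k + d = K) (P : ∀ j, Module.Dual ℝ (S j → ℝ))
    (hP : ∀ j, P j ∈ (k : ℝ) • mixed (S j)) :
    ∃ x ∈ outcomes A B ε K P d, ∀ j a, x.2.1 j a ≤ x.2.2 j + ε := by
  induction d generalizing k P with
  | zero =>
    obtain rfl : k = K := by omega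
    have hk0 : (k : ℝ) ≠ 0 := by exact_mod_cast hK.ne'
    choose p hp hpP using fun j => Set.mem_smul_set.1 (hP j)
    obtain ⟨M, hM, q, hq, h⟩ := exists_product (A := A) hp
    have hBm : ∀ j : Fin m, 0 ≤ B := fun j =>
      (abs_nonneg _).trans (hB j fun i => Classical.arbitrary (S i))
    -- At a leaf no level remains below. The value `r = B` cancels the constant `B` in the bound and
    -- dominates `q` trivially.
    refine ⟨(M, q, fun _ => B), ⟨hM, hq, fun j => (abs_of_nonneg (hBm j)).le, fun j π => ?_⟩,
      fun j a => ?_⟩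
    · have h1 := h j π
      have h2 := h j fun a => a
      rw [deviation_id] at h2
      simp only [h1, h2, ← hpP, LinearMap.smul_apply, smul_eq_mul]
      simp only [CharP.cast_eq_zero, zero_mul]
      linarith
    · have := (abs_le.1 (abs_le_of_mem_convexHull (abs_playerClass_le hB j) (hq j) a)).2
      simp only
      linarith
  | succ d ih =>
    by_contra! hcon
    have hv : ∀ x ∈ outcomes A B ε K P (d + 1 : ℕ), ∃ θ ∈ weighted S, ε < regretForm S θ x := by
      intro x hx
      obtain ⟨j, a, hja⟩ := hcon x hx
      refine ⟨_, single_mem_weighted j a, ?_⟩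
      rw [regretForm_apply, Finset.sum_eq_single j]
      · simp only [Pi.single_eq_same, LinearMap.proj_apply, Pi.sub_apply]
        linarith
      · intro l _ hl
        simp [hl]
      · simp
    have hu : ∀ θ ∈ weighted S, ∃ x ∈ outcomes A B ε K P (d + 1 : ℕ),
        regretForm S θ x < ε / 2 := by
      rintro θ ⟨w, hw, hθ⟩
      choose p hp hpθ using fun j => Set.mem_smul_set.1 (hθ j)
      obtain ⟨⟨M, q, r⟩, ⟨hM, hq, hr, h⟩, hreg⟩ := ih (k + 1) (by omega) (fun j => P j + p j)
        (fun j => by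
          push_cast
          rw [(convex_mixed (S j)).add_smul (Nat.cast_nonneg k) zero_le_one, one_smul]
          exact Set.add_mem_add (hP j) (hp j))
      -- Telescoping: the old `r` absorbs the swapped payoff of `p` up to `ε`, and the value of `p`
      -- itself becomes the new `r`. This makes the weighted regret against `θ` exactly zero.
      refine ⟨(M, q, fun j => p j (q j)), ⟨hM, hq, fun j => abs_mixed_le (hp j)
        (abs_le_of_mem_convexHull (abs_playerClass_le hB j) (hq j)), fun j π => ?_⟩, ?_⟩
      · have h1 := h j π
        have h2 : p j (fun a => q j (π a)) ≤ r j + ε := mixed_le (hp j) fun a => hreg j (π a)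
        simp only [LinearMap.add_apply] at h1 ⊢
        push_cast
        linarith
      · obtain rfl : (fun j => w j • p j) = θ := funext hpθ
        rw [regretForm_weighted hp]
        simpa using half_pos hε
    -- Without players the simplex is empty, so a point is drawn from `hv`, which then contradicts
    -- this emptiness.
    have hne : (weighted S).Nonempty := by
      obtain ⟨x, hx⟩ : (outcomes A B ε K P (d + 1 : ℕ)).Nonempty := by
        by_contra hem
        rw [Set.not_nonempty_iff_eq_empty] at hem
        rcases isEmpty_or_nonempty (Fin m) with hm | ⟨⟨j⟩⟩
        · have hmem : ((LinearMap.proj (fun i => Classical.arbitrary (S i)) :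
              ((∀ i, S i) → ℝ) →ₗ[ℝ] ℝ), (fun j => hm.elim j), fun j => hm.elim j) ∈
              outcomes A B ε K P (d + 1 : ℕ) :=
            ⟨proj_mem_mixed _, fun j => hm.elim j, fun j => hm.elim j, fun j => hm.elim j⟩
          rw [hem] at hmem
          exact hmem
        · obtain ⟨x, hx, -⟩ := hu _ (single_mem_weighted j (Classical.arbitrary (S j)))
          rw [hem] at hx
          exact hx
      obtain ⟨θ, hθ, -⟩ := hv x hx
      exact ⟨θ, hθ⟩
    obtain ⟨θ, x, hθ, hx, hi, lo⟩ := exists_threshold_of_gap (convex_weighted S) hne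
      (convex_outcomes A B ε K P (d + 1 : ℕ)) (regretForm S) hv hu
    choose w hw hθw using hθ
    choose p hp hpθ using fun N j => Set.mem_smul_set.1 (hθw N j)
    have hform : ∀ N n, regretForm S (θ N) (x n) =
        ∑ j, w N j * (p N j ((x n).2.1 j) - (x n).2.2 j) := by
      intro N n
      obtain e : (fun j => w N j • p N j) = θ N := funext (hpθ N)
      rw [← e, regretForm_weighted (hp N)]
    simp only [hform] at hi lo
    refine not_threshold_sum (F := fun j N n => p N j ((x n).2.1 j)) (w := fun j N => w N j)
      (c := fun j n => (x n).2.2 j) (B := B) ?_ ?_ ?_ ?_ ?_ (half_lt_self hε) hi lo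
    · exact fun j N n => abs_mixed_le (hp N j)
        (abs_le_of_mem_convexHull (abs_playerClass_le hB j) ((hx n).2.1 j))
    · intro j N
      rw [abs_of_nonneg ((hw N).1 j), ← (hw N).2]
      exact Finset.single_le_sum (fun i _ => (hw N).1 i) (Finset.mem_univ j)
    · exact fun j N => (hw N).1 j
    · exact fun j n => (hx n).2.2.1 j
    · intro j φ ψ r s hrs hi lo
      exact not_threshold_of_tendsto (abs_playerClass_le hB j) (hR j)
        (p := fun i => p (φ i) j) (q := fun k => (x (ψ k)).2.1 j) (fun i => hp _ _)
        (fun k => (hx _).2.1 j) hrs hi lo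

/-- Bounded games of vanishing sequential Rademacher complexity have approximate correlated
equilibria. -/
theorem exists_isCorrelatedEq [∀ j, Nonempty (S j)] {B : ℝ} (hB0 : 0 ≤ B)
    (hB : ∀ j s, |A j s| ≤ B)
    (hR : ∀ j, Tendsto (seqRademacher (playerClass A j)) atTop (𝓝 0)) {ε : ℝ} (hε : 0 < ε) :
    ∃ μ : PMF (∀ i, S i), IsCorrelatedEq A ε μ := by
  -- With tolerance `ε / 2` per level, the total is `K * (ε / 2) - r j + B`, and `r j ≥ -B - ε / 2`
  -- because `q j ≥ -B`.
  obtain ⟨K, hK⟩ := exists_nat_gt ((2 * B + ε / 2) / (ε / 2))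
  have hKpos : (0 : ℝ) < K := lt_of_le_of_lt (by positivity) hK
  obtain ⟨⟨M, q, r⟩, ⟨hM, hq, hr, h⟩, hreg⟩ := exists_outcome hB hR (half_pos hε)
    (Nat.cast_pos.1 hKpos) K 0 (zero_add K) 0 (fun j => by
      simp [Set.zero_smul_set (mixed_nonempty (S j))])
  obtain ⟨μ, hμ⟩ := exists_pmf_of_mem_mixed hM
  refine ⟨μ, fun j π => ?_⟩
  rw [hμ, hμ]
  have h1 := h j π
  have h2 := hreg j (Classical.arbitrary (S j))
  have h3 := (abs_le.1 (abs_le_of_mem_convexHull (abs_playerClass_le hB j) (hq j)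
    (Classical.arbitrary (S j)))).1
  rw [div_lt_iff₀ (half_pos hε)] at hK
  simp only [Pi.zero_apply, LinearMap.zero_apply] at h1 h2
  have h4 : K * (M (deviation A j π) - M (A j)) ≤ K * ε := by linarith
  have h5 := le_of_mul_le_mul_left h4 hKpos
  change M (deviation A j π) ≤ M (A j) + ε
  linarith

end Game

/-! ### Finite fat-shattering dimension forces vanishing Rademacher complexity. -/

section FatShattering

variable {Z : Type*}

/-- `Shatters δ d V`: the class `V` shatters some tree of depth `d` with margin `δ`. -/
def Shatters (δ : ℝ) : ℕ → Set (Z → ℝ) → Prop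
  | 0, V => V.Nonempty
  | d + 1, V => ∃ (a : Z) (s : ℝ), Shatters δ d {h ∈ V | s + δ ≤ h a} ∧
      Shatters δ d {h ∈ V | h a ≤ s - δ}

theorem Shatters.mono {δ : ℝ} {d : ℕ} {V W : Set (Z → ℝ)} (h : Shatters δ d V) (hVW : V ⊆ W) :
    Shatters δ d W := by
  induction d generalizing V W with
  | zero => exact Set.Nonempty.mono hVW h
  | succ d ih =>
    obtain ⟨a, s, h₁, h₂⟩ := h
    exact ⟨a, s, ih h₁ fun x hx => ⟨hVW hx.1, hx.2⟩, ih h₂ fun x hx => ⟨hVW hx.1, hx.2⟩⟩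

theorem Shatters.exists_tree {δ : ℝ} {d : ℕ} {V : Set (Z → ℝ)} (hV : Shatters δ d V) :
    ∃ (s : BTree ℝ d) (z : BTree Z d), ∀ ε : Fin d → Bool, ∃ h ∈ V, ∀ t : Fin d,
      δ ≤ sgn (ε t) * (h (z.along ε t) - s.along ε t) := by
  induction d generalizing V with
  | zero =>
    obtain ⟨h, hh⟩ := hV
    exact ⟨fun t => t.elim0, fun t => t.elim0, fun ε => ⟨h, hh, fun t => t.elim0⟩⟩
  | succ d ih =>
    obtain ⟨a, r, h₁, h₂⟩ := hV
    obtain ⟨s₁, z₁, h₁⟩ := ih h₁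
    obtain ⟨s₂, z₂, h₂⟩ := ih h₂
    refine ⟨BTree.node r fun b => cond b s₁ s₂, BTree.node a fun b => cond b z₁ z₂, fun ε => ?_⟩
    obtain ⟨b, ε, rfl⟩ : ∃ b ε', ε = (Fin.cons b ε' : Fin (d + 1) → Bool) :=
      ⟨ε 0, Fin.tail ε, (Fin.cons_self_tail ε).symm⟩
    cases b
    · obtain ⟨h, hh, hs⟩ := h₂ ε
      refine ⟨h, hh.1, Fin.cases ?_ fun t => ?_⟩
      · rw [BTree.along_zero, BTree.along_zero, BTree.node_zero, BTree.node_zero, Fin.cons_zero,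
          sgn_false]
        linarith [hh.2]
      · simpa only [BTree.along_cons_succ, BTree.sub_node, Fin.cons_succ, cond_true,
          cond_false] using hs t
    · obtain ⟨h, hh, hs⟩ := h₁ ε
      refine ⟨h, hh.1, Fin.cases ?_ fun t => ?_⟩
      · rw [BTree.along_zero, BTree.along_zero, BTree.node_zero, BTree.node_zero, Fin.cons_zero,
          sgn_true]
        linarith [hh.2]
      · simpa only [BTree.along_cons_succ, BTree.sub_node, Fin.cons_succ, cond_true,
          cond_false] using hs t

theorem exists_not_shatters {δ : ℝ} {H : Set (Z → ℝ)} (h : seqFatDim δ H < ⊤) :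
    ∃ D, ¬ Shatters δ D H := by
  obtain ⟨D, hD⟩ := ENat.ne_top_iff_exists.1 h.ne
  refine ⟨D + 1, fun hs => ?_⟩
  have : ((D + 1 : ℕ) : ℕ∞) ≤ seqFatDim δ H :=
    le_iSup₂ (f := fun (d : ℕ) (_ : d ∈ {d : ℕ | ∃ (s : BTree ℝ d) (z : BTree Z d),
      ∀ ε : Fin d → Bool, ∃ h ∈ H, ∀ t : Fin d,
        δ ≤ sgn (ε t) * (h (z.along ε t) - s.along ε t)}) => (d : ℕ∞)) (D + 1) hs.exists_tree
  rw [← hD, Nat.cast_le] at this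
  omega

/-- Under a dimension bound, at each point all values outside a window of radius `2 δ` are taken on
finitely many subclasses of smaller dimension and small oscillation. -/
theorem exists_window {δ B : ℝ} (hδ : 0 < δ) (hB0 : 0 ≤ B) {V : Set (Z → ℝ)}
    (hB : ∀ h ∈ V, ∀ a, |h a| ≤ B) {D : ℕ} (hV : ¬ Shatters (δ / 2) (D + 1) V) (a : Z) :
    ∃ (y : ℝ) (W : Fin (⌊2 * B / δ⌋₊ + 1) → Set (Z → ℝ)) (c : Fin (⌊2 * B / δ⌋₊ + 1) → ℝ),
      |y| ≤ B ∧ (∀ k, |c k| ≤ B) ∧ (∀ k, W k ⊆ V) ∧ (∀ k, ¬ Shatters (δ / 2) D (W k)) ∧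
      (∀ k, ∀ h ∈ W k, |h a - c k| ≤ 2 * δ) ∧
      ∀ h ∈ V, |h a - y| ≤ 2 * δ ∨ ∃ k, h ∈ W k := by
  classical
  set K := ⌊2 * B / δ⌋₊ + 1 with hKdef
  let c : Fin K → ℝ := fun k => k * δ - B
  let U : Fin K → Set (Z → ℝ) := fun k => {h ∈ V | c k ≤ h a ∧ h a ≤ c k + δ}
  have hc : ∀ k, |c k| ≤ B := by
    intro k
    have h1 : (k : ℝ) ≤ ⌊2 * B / δ⌋₊ := by exact_mod_cast Nat.lt_succ_iff.1 k.2
    have h2 := h1.trans (Nat.floor_le (by positivity))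
    rw [le_div_iff₀ hδ] at h2
    have h3 : 0 ≤ (k : ℝ) * δ := by positivity
    rw [abs_le]
    constructor <;> simp only [c] <;> linarith
  have hcov : ∀ h ∈ V, ∃ k, h ∈ U k := by
    intro h hh
    obtain ⟨h1, h2⟩ := abs_le.1 (hB h hh a)
    have h0 : 0 ≤ (h a + B) / δ := div_nonneg (by linarith) hδ.le
    have hlt : ⌊(h a + B) / δ⌋₊ < K := Nat.lt_succ_of_le (Nat.floor_le_floor (by gcongr; linarith))
    refine ⟨⟨_, hlt⟩, hh, ?_, ?_⟩
    · have := Nat.floor_le h0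
      rw [le_div_iff₀ hδ] at this
      simp only [c]
      linarith
    · have := (Nat.lt_floor_add_one ((h a + B) / δ)).le
      rw [div_le_iff₀ hδ] at this
      simp only [c]
      linarith
  have hclose : ∀ k l : Fin K, k ≤ l → Shatters (δ / 2) D (U k) → Shatters (δ / 2) D (U l) →
      (l : ℕ) ≤ k + 1 := by
    intro k l hkl hk hl
    by_contra! hlt
    -- Buckets whose indices differ by at least two are `δ` apart, so a threshold `δ / 2` above the
    -- lower one separates them with margin `δ / 2`.
    refine hV ⟨a, c k + δ + δ / 2, hl.mono fun h hh => ⟨hh.1, ?_⟩,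
      hk.mono fun h hh => ⟨hh.1, by linarith [hh.2.2]⟩⟩
    have h1 : ((k : ℝ) + 2) ≤ l := by exact_mod_cast hlt
    have h2 := mul_le_mul_of_nonneg_right h1 hδ.le
    have h3 := hh.2.1
    simp only [c] at h3 ⊢
    linarith
  -- `W k` is the bucket if its dimension has dropped, and empty otherwise.
  let W : Fin K → Set (Z → ℝ) := fun k => {h ∈ U k | ¬ Shatters (δ / 2) D (U k)}
  have hW : ∀ k, ¬ Shatters (δ / 2) D (W k) := by
    intro k hs
    by_cases hk : Shatters (δ / 2) D (U k)
    · have hem : W k ⊆ ∅ := fun h hh => hh.2 hk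
      have : ∀ d, ¬ Shatters (δ / 2) d (∅ : Set (Z → ℝ)) := by
        intro d
        induction d with
        | zero => exact Set.not_nonempty_empty
        | succ d ih =>
          rintro ⟨_, _, h, -⟩
          exact ih (h.mono fun x hx => hx.1)
      exact this D (hs.mono hem)
    · exact hk (hs.mono fun h hh => hh.1)
  have hWc : ∀ k, ∀ h ∈ W k, |h a - c k| ≤ 2 * δ := by
    intro k h hh
    obtain ⟨h1, h2⟩ := hh.1.2
    rw [abs_le]
    constructor <;> linarith
  by_cases hex : ∃ k, Shatters (δ / 2) D (U k)
  · obtain ⟨k, hk, hmin⟩ : ∃ k, Shatters (δ / 2) D (U k) ∧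
        ∀ l, Shatters (δ / 2) D (U l) → k ≤ l := by
      have hne : (Finset.univ.filter fun k => Shatters (δ / 2) D (U k)).Nonempty := by
        obtain ⟨k, hk⟩ := hex
        exact ⟨k, by simpa using hk⟩
      refine ⟨_, (Finset.mem_filter.1 (Finset.min'_mem _ hne)).2, fun l hl => ?_⟩
      exact Finset.min'_le _ _ (by simpa using hl)
    -- The buckets of full dimension are the lowest one and possibly its upper neighbour, so they
    -- lie in `[c k, c k + 2 * δ]`.
    refine ⟨c k, W, c, hc k, hc, fun l h hh => hh.1.1, hW, hWc, fun h hh => ?_⟩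
    obtain ⟨l, hl⟩ := hcov h hh
    by_cases hg : Shatters (δ / 2) D (U l)
    · left
      have h1 := hmin l hg
      have h2 := hclose k l h1 hk hg
      have h1' : (k : ℝ) ≤ l := by exact_mod_cast h1
      have h2' : (l : ℝ) ≤ k + 1 := by exact_mod_cast h2
      have h3 := mul_le_mul_of_nonneg_right h1' hδ.le
      have h4 := mul_le_mul_of_nonneg_right h2' hδ.le
      obtain ⟨h5, h6⟩ := hl.2
      simp only [c] at h5 h6 ⊢
      rw [abs_le]
      constructor <;> linarith
    · exact Or.inr ⟨l, hl, hg⟩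
  · refine ⟨0, W, c, by simpa using hB0, hc, fun l h hh => hh.1.1, hW, hWc, fun h hh => ?_⟩
    obtain ⟨l, hl⟩ := hcov h hh
    exact Or.inr ⟨l, hl, fun hs => hex ⟨l, hs⟩⟩

/-- The exponential moment of the signed sums over the branches on which the selection lies in
`V`. -/
def expMoment (lam : ℝ) {T : ℕ} (z : BTree Z T) (h : (Fin T → Bool) → Z → ℝ) (V : Set (Z → ℝ)) :
    ℝ :=
  ∑ ε, (h ⁻¹' V).indicator (fun ε => Real.exp (lam * ∑ t, sgn (ε t) * h ε (z.along ε t))) ε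

/-- When root values are nearly the constant `y`, the first term nearly factors out as `exp (± lam *
y)`, and `cosh x ≤ exp (x ^ 2 / 2)` bounds the two signs together. -/
theorem expMoment_succ_le {lam δ B N : ℝ} (hlam : 0 ≤ lam) {V : Set (Z → ℝ)} {T : ℕ}
    (z : BTree Z (T + 1)) (h : (Fin (T + 1) → Bool) → Z → ℝ) {y : ℝ} (hy : |y| ≤ B)
    (hVy : ∀ x ∈ V, |x (z 0 Fin.elim0) - y| ≤ 2 * δ)
    (hN : ∀ (z : BTree Z T) (h : (Fin T → Bool) → Z → ℝ), expMoment lam z h V ≤ N) (hN0 : 0 ≤ N) :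
    expMoment lam z h V ≤ 2 * Real.exp (lam ^ 2 * B ^ 2 / 2 + 2 * lam * δ) * N := by
  have key : ∀ b : Bool, ∑ ε : Fin T → Bool, (h ⁻¹' V).indicator
      (fun ε => Real.exp (lam * ∑ t, sgn (ε t) * h ε (z.along ε t)))
        (Fin.cons b ε : Fin (T + 1) → Bool) ≤
      Real.exp (sgn b * (lam * y) + 2 * lam * δ) * N := by
    intro b
    refine le_trans ?_ (mul_le_mul_of_nonneg_left (hN (z.sub b) fun ε => h (Fin.cons b ε))
      (Real.exp_pos _).le)
    unfold expMoment
    rw [Finset.mul_sum]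
    refine Finset.sum_le_sum fun ε _ => ?_
    by_cases hmem : h (Fin.cons b ε) ∈ V
    · rw [Set.indicator_of_mem (by exact hmem), Set.indicator_of_mem (by exact hmem),
        ← Real.exp_add, Real.exp_le_exp, Fin.sum_univ_succ, BTree.along_zero, Fin.cons_zero,
        mul_add]
      simp only [Fin.cons_succ, BTree.along_cons_succ]
      refine add_le_add_left ?_ _
      have h1 := hVy _ hmem
      have h2 : sgn b * (h (Fin.cons b ε) (z 0 Fin.elim0) - y) ≤ 2 * δ := by
        refine (le_abs_self _).trans ?_
        rwa [abs_mul, abs_sgn, one_mul]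
      have h3 := mul_le_mul_of_nonneg_left h2 hlam
      linarith
    · rw [Set.indicator_of_notMem (by exact hmem), Set.indicator_of_notMem (by exact hmem),
        mul_zero]
  have hcosh : Real.exp (lam * y) + Real.exp (-(lam * y)) ≤
      2 * Real.exp (lam ^ 2 * B ^ 2 / 2) := by
    have h1 := Real.cosh_le_exp_half_sq (lam * y)
    rw [Real.cosh_eq] at h1
    have h2 : (lam * y) ^ 2 / 2 ≤ lam ^ 2 * B ^ 2 / 2 := by
      rw [mul_pow]
      have := sq_le_sq' (neg_le_of_abs_le hy) (le_of_abs_le hy)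
      gcongr
    have h3 := Real.exp_le_exp.2 h2
    linarith
  unfold expMoment
  rw [sum_signs_succ]
  refine (add_le_add (key true) (key false)).trans ?_
  rw [sgn_true, sgn_false, one_mul, neg_one_mul, Real.exp_add, Real.exp_add, Real.exp_add,
    ← add_mul, ← add_mul, ← mul_assoc]
  gcongr

/-- A sequential Sauer–Shelah recursion on exponential moments: at the root, one window keeps its
dimension while `K` buckets lose one, and every piece has small oscillation there. -/
theorem expMoment_le {lam δ B : ℝ} (hlam : 0 ≤ lam) (hδ : 0 < δ) (hB0 : 0 ≤ B) {T D : ℕ}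
    {V : Set (Z → ℝ)} (hB : ∀ h ∈ V, ∀ a, |h a| ≤ B) (hV : ¬ Shatters (δ / 2) D V)
    (z : BTree Z T) (h : (Fin T → Bool) → Z → ℝ) :
    expMoment lam z h V ≤ (1 + (⌊2 * B / δ⌋₊ + 1 : ℕ) * (T : ℝ)) ^ D *
      (2 * Real.exp (lam ^ 2 * B ^ 2 / 2 + 2 * lam * δ)) ^ T := by
  set K := ⌊2 * B / δ⌋₊ + 1 with hK
  set ρ := 2 * Real.exp (lam ^ 2 * B ^ 2 / 2 + 2 * lam * δ) with hρ
  have hρ0 : 0 < ρ := by positivity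
  induction T generalizing D V with
  | zero =>
    simp only [expMoment, Finset.univ_unique, Finset.sum_singleton, Finset.univ_eq_empty,
      Finset.sum_empty, mul_zero, Real.exp_zero, pow_zero, mul_one, CharP.cast_eq_zero, add_zero,
      one_pow]
    exact Set.indicator_le_self' (fun _ _ => zero_le_one) _
  | succ T ih =>
    cases D with
    | zero =>
      have hem : V = ∅ := Set.not_nonempty_iff_eq_empty.1 hV
      subst hem
      simp only [expMoment, Set.preimage_empty, Set.indicator_empty, Finset.sum_const_zero]
      positivity
    | succ D =>
      obtain ⟨y, W, c, hy, hc, hWV, hW, hWc, hcov⟩ :=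
        exists_window hδ hB0 hB hV (z 0 Fin.elim0)
      set V' := {h ∈ V | |h (z 0 Fin.elim0) - y| ≤ 2 * δ} with hV'
      have h1 : expMoment lam z h V ≤ expMoment lam z h V' + ∑ k, expMoment lam z h (W k) := by
        unfold expMoment
        rw [Finset.sum_comm, ← Finset.sum_add_distrib]
        refine Finset.sum_le_sum fun ε _ => ?_
        set g : (Fin (T + 1) → Bool) → ℝ :=
          fun ε => Real.exp (lam * ∑ t, sgn (ε t) * h ε (z.along ε t))
        have hg : ∀ ε, 0 ≤ g ε := fun ε => (Real.exp_pos _).le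
        have hnn : ∀ X : Set (Fin (T + 1) → Bool), 0 ≤ X.indicator g ε := fun X =>
          Set.indicator_nonneg (fun ε _ => hg ε) ε
        by_cases hmem : h ε ∈ V
        · rw [Set.indicator_of_mem (by exact hmem)]
          rcases hcov _ hmem with hw | ⟨k, hk⟩
          · rw [Set.indicator_of_mem (by exact ⟨hmem, hw⟩)]
            exact le_add_of_nonneg_right (Finset.sum_nonneg fun k _ => hnn _)
          · refine le_trans ?_ (le_add_of_nonneg_left (hnn _))
            refine le_trans ?_ (Finset.single_le_sum (fun k _ => hnn (h ⁻¹' W k))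
              (Finset.mem_univ k))
            rw [Set.indicator_of_mem (by exact hk)]
        · rw [Set.indicator_of_notMem (by exact hmem)]
          exact add_nonneg (hnn _) (Finset.sum_nonneg fun k _ => hnn _)
      have h2 : expMoment lam z h V' ≤ ρ * ((1 + (K : ℝ) * T) ^ (D + 1) * ρ ^ T) :=
        expMoment_succ_le hlam z h hy (fun x hx => hx.2)
          (ih (fun x hx => hB x hx.1) fun hs => hV (hs.mono fun x hx => hx.1)) (by positivity)
      have h3 : ∀ k, expMoment lam z h (W k) ≤ ρ * ((1 + (K : ℝ) * T) ^ D * ρ ^ T) := fun k =>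
        expMoment_succ_le hlam z h (hc k) (hWc k)
          (ih (fun x hx => hB x (hWV k hx)) (hW k)) (by positivity)
      have h4 : ∑ k, expMoment lam z h (W k) ≤ K * (ρ * ((1 + (K : ℝ) * T) ^ D * ρ ^ T)) := by
        refine (Finset.sum_le_card_nsmul _ _ _ fun k _ => h3 k).trans_eq ?_
        rw [Finset.card_univ, Fintype.card_fin, nsmul_eq_mul]
      calc expMoment lam z h V
          ≤ ρ * ((1 + (K : ℝ) * T) ^ (D + 1) * ρ ^ T) +
              K * (ρ * ((1 + (K : ℝ) * T) ^ D * ρ ^ T)) := h1.trans (add_le_add h2 h4)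
        _ = (1 + (K : ℝ) * T) ^ D * (1 + K * (T + 1 : ℕ)) * ρ ^ (T + 1) := by
            push_cast
            ring
        _ ≤ (1 + (K : ℝ) * (T + 1 : ℕ)) ^ D * (1 + K * (T + 1 : ℕ)) * ρ ^ (T + 1) := by
            gcongr
            exact Nat.le_succ T
        _ = (1 + (K : ℝ) * (T + 1 : ℕ)) ^ (D + 1) * ρ ^ (T + 1) := by rw [pow_succ _ D]

/-- The moment bound applied to near-optimal selections on each branch; Jensen's inequality enters
as the tangent-line bound `x + 1 ≤ exp x` after recentring at `C`. -/
theorem seqRademacher_le [Nonempty Z] {lam δ B : ℝ} (hlam : 0 < lam) (hδ : 0 < δ) (hB0 : 0 ≤ B)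
    {D : ℕ} {H : Set (Z → ℝ)} (hne : H.Nonempty) (hB : ∀ h ∈ H, ∀ a, |h a| ≤ B)
    (hH : ¬ Shatters (δ / 2) D H) {T : ℕ} (hT : 0 < T) :
    seqRademacher H T ≤ D / lam * (Real.log (1 + (⌊2 * B / δ⌋₊ + 1 : ℕ) * (T : ℝ)) / T) +
      (lam * B ^ 2 / 2 + 2 * δ) := by
  have : Nonempty H := hne.to_subtype
  have hT' : (0 : ℝ) < T := by exact_mod_cast hT
  set K := ⌊2 * B / δ⌋₊ + 1
  set L := Real.log (1 + (K : ℝ) * T) with hL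
  have hexpL : Real.exp L = 1 + (K : ℝ) * T := Real.exp_log (by positivity)
  refine ciSup_le fun z => ?_
  refine le_of_forall_pos_le_add fun η hη => ?_
  have hsel : ∀ ε : Fin T → Bool, ∃ x : H, (⨆ h : H, (1 / (T : ℝ)) *
      ∑ t : Fin T, sgn (ε t) * (h : Z → ℝ) (z.along ε t)) - η <
      (1 / (T : ℝ)) * ∑ t : Fin T, sgn (ε t) * (x : Z → ℝ) (z.along ε t) := fun ε =>
    exists_lt_of_lt_ciSup (sub_lt_self _ hη)
  choose x hx using hsel
  set C := D * L + T * (lam ^ 2 * B ^ 2 / 2 + 2 * lam * δ) with hC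
  have hmom := expMoment_le (T := T) hlam.le hδ hB0 hB hH z (fun ε => x ε)
  have hbound : (1 + (K : ℝ) * T) ^ D *
      (2 * Real.exp (lam ^ 2 * B ^ 2 / 2 + 2 * lam * δ)) ^ T = 2 ^ T * Real.exp C := by
    rw [← hexpL, hC, Real.exp_add (D * L), mul_pow, ← Real.exp_nat_mul, ← Real.exp_nat_mul]
    ring
  rw [hbound] at hmom
  set X : (Fin T → Bool) → ℝ := fun ε => ∑ t, sgn (ε t) * (x ε : Z → ℝ) (z.along ε t) with hX
  have hmom' : ∑ ε, Real.exp (lam * X ε) ≤ 2 ^ T * Real.exp C := by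
    refine le_trans (Finset.sum_le_sum fun ε _ => ?_) hmom
    rw [Set.indicator_of_mem (by exact (x ε).2)]
  have hlin : ∑ ε, (lam * X ε - C + 1) ≤ 2 ^ T := by
    calc ∑ ε, (lam * X ε - C + 1) ≤ ∑ ε, Real.exp (lam * X ε) * Real.exp (-C) := by
          refine Finset.sum_le_sum fun ε _ => ?_
          rw [← Real.exp_add, ← sub_eq_add_neg]
          exact Real.add_one_le_exp _
      _ ≤ 2 ^ T * Real.exp C * Real.exp (-C) := by
          rw [← Finset.sum_mul]
          gcongr
      _ = 2 ^ T := by rw [mul_assoc, ← Real.exp_add, add_neg_cancel, Real.exp_zero, mul_one]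
  have hsum : lam * ∑ ε, X ε ≤ 2 ^ T * C := by
    rw [Finset.sum_add_distrib, Finset.sum_sub_distrib, ← Finset.mul_sum] at hlin
    simp only [Finset.sum_const, Finset.card_univ, Fintype.card_pi, Fintype.card_bool,
      Finset.prod_const, Fintype.card_fin, nsmul_eq_mul, Nat.cast_pow, Nat.cast_ofNat,
      mul_one] at hlin
    linarith
  have h2 : (0 : ℝ) < 2 ^ T := by positivity
  have hsup : ∑ ε : Fin T → Bool, (⨆ h : H, (1 / (T : ℝ)) *
      ∑ t : Fin T, sgn (ε t) * (h : Z → ℝ) (z.along ε t)) ≤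
      (1 / (T : ℝ)) * ∑ ε, X ε + 2 ^ T * η := by
    calc _ ≤ ∑ ε : Fin T → Bool, ((1 / (T : ℝ)) * X ε + η) :=
          Finset.sum_le_sum fun ε _ => by linarith [hx ε]
      _ = _ := by
          rw [Finset.sum_add_distrib, ← Finset.mul_sum]
          simp
  have hfin : (1 / (T : ℝ)) * ∑ ε, X ε ≤ 2 ^ T * (D / lam * (L / T) +
      (lam * B ^ 2 / 2 + 2 * δ)) := by
    have e : 2 ^ T * (D / lam * (L / T) + (lam * B ^ 2 / 2 + 2 * δ)) =
        (1 / (T : ℝ)) * (2 ^ T * C / lam) := by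
      rw [hC]
      field_simp
    rw [e]
    refine mul_le_mul_of_nonneg_left ?_ (by positivity)
    rw [le_div_iff₀ hlam]
    linarith
  rw [div_le_iff₀ h2]
  linarith

/-- A bounded class all of whose fat-shattering dimensions are finite has vanishing sequential
Rademacher complexity. -/
theorem tendsto_seqRademacher [Nonempty Z] {B : ℝ} (hB0 : 0 ≤ B) {H : Set (Z → ℝ)}
    (hne : H.Nonempty) (hB : ∀ h ∈ H, ∀ a, |h a| ≤ B)
    (hfat : ∀ δ : ℝ, 0 < δ → seqFatDim δ H < ⊤) :
    Tendsto (seqRademacher H) atTop (𝓝 0) := by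
  rw [tendsto_order]
  refine ⟨fun a ha => Eventually.of_forall fun T =>
    ha.trans_le (seqRademacher_nonneg hne hB T), fun η hη => ?_⟩
  obtain ⟨D, hD⟩ := exists_not_shatters (hfat (η / 8 / 2) (by positivity))
  set K := ⌊2 * B / (η / 8)⌋₊ + 1 with hK
  have hK0 : (0 : ℝ) < K := by positivity
  set lam := η / (2 * (B ^ 2 + 1)) with hlamdef
  have hlam : 0 < lam := by positivity
  have hlamB : lam * B ^ 2 / 2 ≤ η / 4 := by
    rw [hlamdef, div_mul_eq_mul_div, div_div, div_le_div_iff₀ (by positivity) (by positivity)]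
    nlinarith [sq_nonneg B]
  have hlog : Tendsto (fun T : ℕ => D / lam * (Real.log (1 + (K : ℝ) * (T : ℝ)) / T)) atTop
      (𝓝 0) := by
    -- The coefficients make the denominator equal to `T` at `x = 1 + K * T`.
    have h1 := Real.tendsto_pow_log_div_mul_add_atTop (1 / (K : ℝ)) (-(1 / (K : ℝ))) 1
      (by positivity)
    have h2 : Tendsto (fun T : ℕ => 1 + (K : ℝ) * (T : ℝ)) atTop atTop :=
      tendsto_atTop_add_const_left _ _
        (tendsto_natCast_atTop_atTop.const_mul_atTop hK0)
    have h3 := (h1.comp h2).const_mul (D / lam)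
    rw [mul_zero] at h3
    refine h3.congr fun T => ?_
    simp only [Function.comp, pow_one]
    congr 2
    field_simp
    ring
  filter_upwards [hlog.eventually_lt_const (half_pos (half_pos hη)), eventually_gt_atTop 0]
    with T hT1 hT0
  have := seqRademacher_le hlam (δ := η / 8) (by positivity) hB0 hne hB hD hT0
  rw [← hK] at this
  linarith

theorem BTree.along_update {Y : Type*} {d : ℕ} (y : BTree Y d) (ε : Fin d → Bool) (t : Fin d)
    (b : Bool) : y.along (Function.update ε t b) t = y.along ε t := by
  unfold BTree.along
  congr 1
  funext i
  refine Function.update_of_ne (fun he => ?_) _ _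
  have := congrArg Fin.val he
  simp at this
  omega

/-- The same tree works: flipping the sign at level `t` keeps the node and its threshold, so members
of the class lie strictly on both sides of it and the values `0` and `1` must match the signs. -/
theorem seqFatDim_le_littlestoneDim {δ : ℝ} (hδ : 0 < δ) {H : Set (Z → ℝ)}
    (hH : ∀ h ∈ H, ∀ a, h a = 0 ∨ h a = 1) : seqFatDim δ H ≤ littlestoneDim H := by
  refine iSup₂_le fun d hd => ?_
  obtain ⟨s, z, hsz⟩ := hd
  refine le_iSup₂ (f := fun (d : ℕ) (_ : d ∈ {d : ℕ | ∃ z : BTree Z d, ∀ ε : Fin d → Bool,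
    ∃ h ∈ H, ∀ t : Fin d, h (z.along ε t) = if ε t then 1 else 0}) => (d : ℕ∞)) d ⟨z, fun ε => ?_⟩
  obtain ⟨h, hh, ht⟩ := hsz ε
  refine ⟨h, hh, fun t => ?_⟩
  obtain ⟨h', hh', ht'⟩ := hsz (Function.update ε t !(ε t))
  have h1 := ht t
  have h2 := ht' t
  rw [z.along_update, s.along_update, Function.update_self] at h2
  cases hεt : ε t
  · rw [hεt, sgn_false] at h1
    rw [hεt, Bool.not_false, sgn_true] at h2
    rcases hH h hh (z.along ε t) with h0 | h0
    · simpa using h0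
    · rcases hH h' hh' (z.along ε t) with h0' | h0' <;> linarith
  · rw [hεt, sgn_true] at h1
    rw [hεt, Bool.not_true, sgn_false] at h2
    rcases hH h hh (z.along ε t) with h0 | h0
    · rcases hH h' hh' (z.along ε t) with h0' | h0' <;> linarith
    · simpa using h0

end FatShattering

/-! ### From classes to games. -/

section Game

variable {m : ℕ} {S : Fin m → Type*} {A : Fin m → (∀ i, S i) → ℝ}

theorem exists_uniform_bound (hA : ∀ j, ∃ B : ℝ, ∀ s, |A j s| ≤ B) :
    ∃ B : ℝ, 0 ≤ B ∧ ∀ j s, |A j s| ≤ B := by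
  choose B hB using hA
  refine ⟨∑ j, |B j|, Finset.sum_nonneg fun j _ => abs_nonneg _, fun j s => ?_⟩
  exact ((hB j s).trans (le_abs_self _)).trans
    (Finset.single_le_sum (f := fun j => |B j|) (fun j _ => abs_nonneg _) (Finset.mem_univ j))

/-- The complexities are nonnegative, so the finite maximum lies between each of them and their sum.
-/
theorem tendsto_gameSeqRademacher_iff [∀ j, Nonempty (S j)] {B : ℝ} (hB : ∀ j s, |A j s| ≤ B) :
    Tendsto (fun T => gameSeqRademacher A T) atTop (𝓝 0) ↔
      ∀ j, Tendsto (seqRademacher (playerClass A j)) atTop (𝓝 0) := by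
  have hnn : ∀ j T, 0 ≤ seqRademacher (playerClass A j) T := fun j T =>
    seqRademacher_nonneg (playerClass_nonempty A j) (abs_playerClass_le hB j) T
  constructor
  · intro h j
    exact squeeze_zero (hnn j) (fun T => le_ciSup
      (f := fun j => seqRademacher (playerClass A j) T) (Set.finite_range _).bddAbove j) h
  · intro h
    have hsum := tendsto_finsetSum (Finset.univ : Finset (Fin m)) fun j _ => h j
    rw [Finset.sum_const_zero] at hsum
    refine squeeze_zero (fun T => Real.iSup_nonneg fun j => hnn j T) (fun T => ?_) hsum
    exact Real.iSup_le (fun j => Finset.single_le_sum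
      (f := fun j => seqRademacher (playerClass A j) T) (fun i _ => hnn i T) (Finset.mem_univ j))
      (Finset.sum_nonneg fun i _ => hnn i T)

theorem tendsto_gameSeqRademacher_of_fat [∀ j, Nonempty (S j)]
    (hA : ∀ j, ∃ B : ℝ, ∀ s, |A j s| ≤ B)
    (hfat : ∀ δ : ℝ, 0 < δ → ∀ j, seqFatDim δ (playerClass A j) < ⊤) :
    Tendsto (fun T => gameSeqRademacher A T) atTop (𝓝 0) := by
  obtain ⟨B, hB0, hB⟩ := exists_uniform_bound hA
  exact (tendsto_gameSeqRademacher_iff hB).2 fun j => tendsto_seqRademacher hB0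
    (playerClass_nonempty A j) (abs_playerClass_le hB j) fun δ hδ => hfat δ hδ j

end Game

end SeqGame

end

theorem corollary3p5 {m : ℕ} {S : Fin m → Type*} [∀ j, Nonempty (S j)]
    (A : Fin m → (∀ i, S i) → ℝ) (hA : ∀ j, ∃ B : ℝ, ∀ s, |A j s| ≤ B) :
    ((∀ δ : ℝ, 0 < δ → SeqGame.gameSeqFatDim δ A < ⊤) →
      Tendsto (fun T : ℕ => SeqGame.gameSeqRademacher A T) atTop (𝓝 0)) ∧
    ((Tendsto (fun T : ℕ => SeqGame.gameSeqRademacher A T) atTop (𝓝 0) ∨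
        (SeqGame.IsBinaryValued A ∧ SeqGame.gameLittlestoneDim A < ⊤)) →
      ∀ ε : ℝ, 0 < ε → ∃ μ : PMF (∀ i, S i), SeqGame.IsCorrelatedEq A ε μ) := by
  refine ⟨fun hfat => SeqGame.tendsto_gameSeqRademacher_of_fat hA fun δ hδ j =>
    (le_iSup (fun j => SeqGame.seqFatDim δ (SeqGame.playerClass A j)) j).trans_lt (hfat δ hδ),
    fun h ε hε => ?_⟩
  obtain ⟨B, hB0, hB⟩ := SeqGame.exists_uniform_bound hA
  have hR : Tendsto (fun T : ℕ => SeqGame.gameSeqRademacher A T) atTop (𝓝 0) := by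
    rcases h with h | ⟨hbin, hL⟩
    · exact h
    · refine SeqGame.tendsto_gameSeqRademacher_of_fat hA fun δ hδ j => ?_
      refine (SeqGame.seqFatDim_le_littlestoneDim hδ ?_).trans_lt
        ((le_iSup (fun j => SeqGame.littlestoneDim (SeqGame.playerClass A j)) j).trans_lt hL)
      rintro _ ⟨s, rfl⟩ a
      exact hbin j _
  exact SeqGame.exists_isCorrelatedEq hB0 hB ((SeqGame.tendsto_gameSeqRademacher_iff hB).1 hR) hε
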